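/- Let $A$ and $B$ be qubits, write $D(A)$ for the superoperators $\mathcal{E}^+-\mathcal{E}^-$ with $\mathcal{E}^{\pm}$ and $\mathcal{E}^++\mathcal{E}^-$ completely positive and trace-nonincreasing, and consider three sets of maps on $A\otimes B$. $\mathrm{LO}$ consists of the products $\mathcal{A}\otimes\mathcal{B}$ with $\mathcal{A}\in D(A)$, $\mathcal{B}\in D(B)$. $\mathrm{LO}\overrightarrow{\mathrm{CC}}$ consists of the maps realized by local operations together with classical communication from $A$ to $B$, and $\mathrm{LOCC}$ of those realized by local operations together with two-way classical communication in finitely many rounds. In the last two sets the measurement outcomes of the local instruments may be weighted by signs $\pm1$, as in $D$. For $S$ one of these three sets and a two-qubit unitary $U$ with channel $\mathcal{U}(X)=UXU^\dagger$, let $$\gamma_S(U)=\min\Big\{\sum_{i=1}^m|a_i| \;:\; \mathcal{U}=\sum_{i=1}^m a_i\mathcal{F}_i,\ m\ge 1,\ a_i\in\mathbb{R},\ \mathcal{F}_i\in S\Big\}.$$ Let $X,Y,Z$ be the Pauli matrices and, for $\sigma\in\{X,Y,Z\}$, let $R_\sigma(\theta)=e^{-i\frac{\theta}{2}\sigma}$,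 let $\mathrm{CR}_\sigma(\theta)=|0\rangle\langle 0|\otimes 1+|1\rangle\langle 1|\otimes R_\sigma(\theta)$ and $\mathrm{R}_{\sigma\sigma}(\theta)=e^{-i\frac{\theta}{2}\sigma\otimes\sigma}$. A two-qubit Clifford gate is a two-qubit unitary $U$ with $UP_2U^\dagger=P_2$, where $P_2=\{i^k\,\sigma\otimes\tau : k\in\mathbb{Z},\ \sigma,\tau\in\{1,X,Y,Z\}\}$ is the two-qubit Pauli group. Then classical communication gives no advantage for a single instance of any of the following gates; all the minima below exist. 1. For every two-qubit Clifford gate $U$, $\gamma_{\mathrm{LOCC}}(U)=\gamma_{\mathrm{LO}\overrightarrow{\mathrm{CC}}}(U)=\gamma_{\mathrm{LO}}(U)\in\{1,3,7\}$. In particular, $$\gamma_{\mathrm{LOCC}}(\mathrm{CNOT})=\gamma_{\mathrm{LO}\overrightarrow{\mathrm{CC}}}(\mathrm{CNOT})=\gamma_{\mathrm{LO}}(\mathrm{CNOT})=3,$$ $$\gamma_{\mathrm{LOCC}}(\mathrm{iSWAP})=\gamma_{\mathrm{LO}\overrightarrow{\mathrm{CC}}}(\mathrm{iSWAP})=\gamma_{\mathrm{LO}}(\mathrm{iSWAP})=7,$$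 $$\gamma_{\mathrm{LOCC}}(\mathrm{SWAP})=\gamma_{\mathrm{LO}\overrightarrow{\mathrm{CC}}}(\mathrm{SWAP})=\gamma_{\mathrm{LO}}(\mathrm{SWAP})=7.$$ 2. For all $\sigma\in\{X,Y,Z\}$ and $\theta\in[0,2\pi]$, $$\gamma_{\mathrm{LOCC}}(\mathrm{CR}_\sigma(\theta))=\gamma_{\mathrm{LO}\overrightarrow{\mathrm{CC}}}(\mathrm{CR}_\sigma(\theta))=\gamma_{\mathrm{LO}}(\mathrm{CR}_\sigma(\theta))=1+2|\sin(\theta/2)|.$$ 3. For all $\sigma\in\{X,Y,Z\}$ and $\theta\in[0,2\pi]$, $$\gamma_{\mathrm{LOCC}}(\mathrm{R}_{\sigma\sigma}(\theta))=\gamma_{\mathrm{LO}\overrightarrow{\mathrm{CC}}}(\mathrm{R}_{\sigma\sigma}(\theta))=\gamma_{\mathrm{LO}}(\mathrm{R}_{\sigma\sigma}(\theta))=1+2|\sin\theta|.$$ -/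

import Mathlib

open Matrix
open scoped Kronecker ComplexOrder

noncomputable section

/-- Linear superoperators from the operators on the system with basis `α` to those on the
system with basis `β`. A `d`-dimensional system has basis `Fin d`; the composite of two such
systems has basis `Fin m × Fin n`. -/
abbrev SuperOp (α β : Type) : Type := Matrix α α ℂ →ₗ[ℂ] Matrix β β ℂ

/-- The tensor product `Φ ⊗ Ψ` of superoperators: the linear map with
`X ⊗ Y ↦ Φ X ⊗ Ψ Y`, written out on the matrix units. -/
def tensorOp {m n m' n' : ℕ} (Φ : SuperOp (Fin m) (Fin m')) (Ψ : SuperOp (Fin n) (Fin n')) :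
    SuperOp (Fin m × Fin n) (Fin m' × Fin n') where
  toFun X := ∑ p : Fin m × Fin n, ∑ q : Fin m × Fin n,
    X p q • (Φ (Matrix.single p.1 q.1 1) ⊗ₖ Ψ (Matrix.single p.2 q.2 1))
  map_add' X Y := by
    simp only [Matrix.add_apply, add_smul, Finset.sum_add_distrib]
  map_smul' c X := by
    simp only [Matrix.smul_apply, smul_eq_mul, mul_smul, Finset.smul_sum, RingHom.id_apply]

/-- The tensor product acts on product operators as it should. -/
theorem tensorOp_kronecker {m n m' n' : ℕ} (Φ : SuperOp (Fin m) (Fin m'))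
    (Ψ : SuperOp (Fin n) (Fin n')) (X : Matrix (Fin m) (Fin m) ℂ)
    (Y : Matrix (Fin n) (Fin n) ℂ) :
    tensorOp Φ Ψ (X ⊗ₖ Y) = Φ X ⊗ₖ Ψ Y := by
  have hX : Φ X = ∑ i, ∑ j, X i j • Φ (Matrix.single i j 1) := by
    conv_lhs => rw [Matrix.matrix_eq_sum_single X]
    simp only [map_sum]
    refine Finset.sum_congr rfl fun i _ => Finset.sum_congr rfl fun j _ => ?_
    rw [← map_smul, Matrix.smul_single, smul_eq_mul, mul_one]
  have hY : Ψ Y = ∑ i, ∑ j, Y i j • Ψ (Matrix.single i j 1) := by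
    conv_lhs => rw [Matrix.matrix_eq_sum_single Y]
    simp only [map_sum]
    refine Finset.sum_congr rfl fun i _ => Finset.sum_congr rfl fun j _ => ?_
    rw [← map_smul, Matrix.smul_single, smul_eq_mul, mul_one]
  ext a b
  simp only [hX, hY, tensorOp, LinearMap.coe_mk, AddHom.coe_mk, Matrix.kroneckerMap_apply,
    Matrix.sum_apply, Matrix.smul_apply, smul_eq_mul, ← Fintype.sum_prod_type',
    Finset.sum_mul_sum]
  refine Fintype.sum_equiv (Equiv.prodProdProdComm _ _ _ _) _ _ fun x => ?_
  simp only [Equiv.prodProdProdComm_apply]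
  ring

/-- Complete positivity: `id_k ⊗ Φ` maps positive semidefinite operators to positive
semidefinite operators, for every dimension `k` of the reference system. -/
def IsCP {m n : ℕ} (Φ : SuperOp (Fin m) (Fin n)) : Prop :=
  ∀ (k : ℕ) (X : Matrix (Fin k × Fin m) (Fin k × Fin m) ℂ), X.PosSemidef →
    (tensorOp (LinearMap.id : SuperOp (Fin k) (Fin k)) Φ X).PosSemidef

/-- Completely positive trace-nonincreasing maps. -/
def IsCPTN {m n : ℕ} (Φ : SuperOp (Fin m) (Fin n)) : Prop :=
  IsCP Φ ∧ ∀ X : Matrix (Fin m) (Fin m) ℂ, X.PosSemidef → (Φ X).trace.re ≤ X.trace.re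

/-- The class `D`: differences of two completely positive trace-nonincreasing maps whose sum is
again completely positive and trace-nonincreasing. -/
def IsD {m n : ℕ} (Φ : SuperOp (Fin m) (Fin n)) : Prop :=
  ∃ P N : SuperOp (Fin m) (Fin n), IsCPTN P ∧ IsCPTN N ∧ Φ = P - N ∧ IsCPTN (P + N)

/-- A local instrument with finitely many outcomes `k`, in which each outcome also carries a
sign by which the final result is weighted: branch `k` is `P k - N k`, where all `P k`, `N k` are
completely positive and their total sum is trace-nonincreasing. With a single outcome these are
the members of `D`. -/
def IsSignedInstrument {m n K : ℕ} (A : Fin K → SuperOp (Fin m) (Fin n)) : Prop :=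
  ∃ P N : Fin K → SuperOp (Fin m) (Fin n),
    (∀ k, IsCP (P k)) ∧ (∀ k, IsCP (N k)) ∧ (∀ k, A k = P k - N k) ∧
      IsCPTN (∑ k, (P k + N k))

/-- Local operations: products of a member of `D(A)` and a member of `D(B)`. -/
def LO (a b : ℕ) : Set (SuperOp (Fin a × Fin b) (Fin a × Fin b)) :=
  {F | ∃ (Φ : SuperOp (Fin a) (Fin a)) (Ψ : SuperOp (Fin b) (Fin b)),
    IsD Φ ∧ IsD Ψ ∧ F = tensorOp Φ Ψ}

/-- Local operations and one-way classical communication from `A` to `B`: `A` applies an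
instrument and sends the outcome `k` to `B`, who applies a local operation depending on `k`. -/
def LOOneWayCC (a b : ℕ) : Set (SuperOp (Fin a × Fin b) (Fin a × Fin b)) :=
  {F | ∃ (K : ℕ) (Φ : Fin K → SuperOp (Fin a) (Fin a)) (Ψ : Fin K → SuperOp (Fin b) (Fin b)),
    IsSignedInstrument Φ ∧ (∀ k, IsD (Ψ k)) ∧ F = ∑ k, tensorOp (Φ k) (Ψ k)}

/-- Protocols of local operations and two-way classical communication with finitely many
rounds, with output systems of dimensions `a`, `b`. Either both parties finish with a local
operation, or one of them applies an instrument, announces the outcome `k`, and both go on with a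
protocol that depends on `k` (hence on all previous outcomes). The local systems may change
dimension in between, so that the parties may use local ancillas and local memory. -/
inductive IsLOCC (a b : ℕ) :
    {m n : ℕ} → SuperOp (Fin m × Fin n) (Fin a × Fin b) → Prop
  | finish {m n : ℕ} (Φ : SuperOp (Fin m) (Fin a)) (Ψ : SuperOp (Fin n) (Fin b))
      (hΦ : IsD Φ) (hΨ : IsD Ψ) : IsLOCC a b (tensorOp Φ Ψ)
  | roundA {m m' n K : ℕ} (Φ : Fin K → SuperOp (Fin m) (Fin m')) (hΦ : IsSignedInstrument Φ)
      (F : Fin K → SuperOp (Fin m' × Fin n) (Fin a × Fin b)) (hF : ∀ k, IsLOCC a b (F k)) :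
      IsLOCC a b (∑ k, F k ∘ₗ tensorOp (Φ k) (LinearMap.id : SuperOp (Fin n) (Fin n)))
  | roundB {m n n' K : ℕ} (Ψ : Fin K → SuperOp (Fin n) (Fin n')) (hΨ : IsSignedInstrument Ψ)
      (F : Fin K → SuperOp (Fin m × Fin n') (Fin a × Fin b)) (hF : ∀ k, IsLOCC a b (F k)) :
      IsLOCC a b (∑ k, F k ∘ₗ tensorOp (LinearMap.id : SuperOp (Fin m) (Fin m)) (Ψ k))

/-- The maps on `A ⊗ B` realized by finite-round LOCC protocols. -/
def LOCC (a b : ℕ) : Set (SuperOp (Fin a × Fin b) (Fin a × Fin b)) :=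
  {F | IsLOCC a b F}

/-- The one-norms `∑ |a i|` of all quasiprobability decompositions `E = ∑ a i • F i` of `E` into
members `F i` of `S` with real coefficients. -/
def qpdCosts {α : Type} (S : Set (SuperOp α α)) (E : SuperOp α α) : Set ℝ :=
  {κ | ∃ (m : ℕ) (a : Fin m → ℝ) (F : Fin m → SuperOp α α), 1 ≤ m ∧ (∀ i, F i ∈ S) ∧
    E = ∑ i, (a i : ℂ) • F i ∧ κ = ∑ i, |a i|}

/-- The channel `X ↦ U X U†`. -/
def unitaryChannel {α : Type} [Fintype α] (U : Matrix α α ℂ) : SuperOp α α :=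
  LinearMap.mulLeft ℂ U ∘ₗ LinearMap.mulRight ℂ Uᴴ

/-- `g` is the γ-factor of the unitary `U` over `S`: the minimal one-norm (in particular it is
attained) of a quasiprobability decomposition of the channel of `U` into members of `S`. -/
def IsGammaFactor {α : Type} [Fintype α] (S : Set (SuperOp α α)) (U : Matrix α α ℂ) (g : ℝ) :
    Prop :=
  IsLeast (qpdCosts S (unitaryChannel U)) g

/-- Operators on one qubit. -/
abbrev QubitMat : Type := Matrix (Fin 2) (Fin 2) ℂ

/-- Operators on two qubits; the first belongs to `A`, the second to `B`. -/
abbrev TwoQubitMat : Type := Matrix (Fin 2 × Fin 2) (Fin 2 × Fin 2) ℂ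

/-- The Pauli matrices. -/
def pauliX : QubitMat := !![0, 1; 1, 0]

def pauliY : QubitMat := !![0, -Complex.I; Complex.I, 0]

def pauliZ : QubitMat := !![1, 0; 0, -1]

/-- The two-qubit Pauli group: all `i^k σ ⊗ τ` with `σ, τ ∈ {1, X, Y, Z}`. -/
def pauliGroup₂ : Set TwoQubitMat :=
  {M | ∃ (k : ℕ) (σ τ : QubitMat), σ ∈ ({1, pauliX, pauliY, pauliZ} : Set QubitMat) ∧
    τ ∈ ({1, pauliX, pauliY, pauliZ} : Set QubitMat) ∧ M = Complex.I ^ k • (σ ⊗ₖ τ)}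

/-- Two-qubit Clifford gates: unitaries `U` with `U P U† = P` for the two-qubit Pauli
group `P`. -/
def IsClifford₂ (U : TwoQubitMat) : Prop :=
  U ∈ Matrix.unitaryGroup (Fin 2 × Fin 2) ℂ ∧ (fun M => U * M * Uᴴ) '' pauliGroup₂ = pauliGroup₂

/-- The controlled-`V` gate `|0⟩⟨0| ⊗ 1 + |1⟩⟨1| ⊗ V`; the first qubit is the control. -/
def controlled (V : QubitMat) : TwoQubitMat :=
  Matrix.single 0 0 1 ⊗ₖ (1 : QubitMat) + Matrix.single 1 1 1 ⊗ₖ V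

def gateCNOT : TwoQubitMat := controlled pauliX

/-- `|ij⟩ ↦ |ji⟩`. -/
def gateSWAP : TwoQubitMat := Matrix.of fun p q => if p = q.swap then 1 else 0

/-- `|ii⟩ ↦ |ii⟩`, `|01⟩ ↦ i |10⟩`, `|10⟩ ↦ i |01⟩`. -/
def gateISWAP : TwoQubitMat :=
  Matrix.of fun p q => if p = q.swap then (if q.1 = q.2 then 1 else Complex.I) else 0

/-- The rotation `R_σ(θ) = exp(-i (θ/2) σ)`. -/
def rot (σ : QubitMat) (θ : ℝ) : QubitMat :=
  NormedSpace.exp ((-Complex.I * ((θ : ℂ) / 2)) • σ)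

/-- The controlled rotation `CR_σ(θ)`. -/
def gateCR (σ : QubitMat) (θ : ℝ) : TwoQubitMat := controlled (rot σ θ)

/-- The two-qubit rotation `R_σσ(θ) = exp(-i (θ/2) σ ⊗ σ)`. -/
def gateRR (σ : QubitMat) (θ : ℝ) : TwoQubitMat :=
  NormedSpace.exp ((-Complex.I * ((θ : ℂ) / 2)) • (σ ⊗ₖ σ))

/-- The three settings for a pair of qubits. -/
def qubitSettings : Set (Set (SuperOp (Fin 2 × Fin 2) (Fin 2 × Fin 2))) :=
  {LO 2 2, LOOneWayCC 2 2, LOCC 2 2}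

end

/-! Every gate in question can be written `U = ∑ u i • (A i ⊗ B i)` with real `u`, `∑ u i ^ 2 = 1`,
and two families of local unitaries, each orthogonal for the Hilbert–Schmidt inner product. For such
a gate all three γ-factors equal `2 s² - 1` with `s = ∑ |u i|` (`HasUnitarySchmidt.isGammaFactor`).
Since `LO ⊆ LOOneWayCC ⊆ LOCC`, it suffices to attain this cost in LO and to bound it from below in
LOCC.

Upper bound (`mem_qpdCosts_LO`): expanding `U X U†` gives diagonal terms of total weight 1, and for
each ordered pair `i ≠ j` the Hermitian part of a product map. The latter splits like `Re (zw) = Re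
z Re w - Im z Im w` into two products of members of `D`, at cost `2 |u i u j|`.

Lower bound: each LOCC map is a difference of separable maps with trace-nonincreasing sum
(`IsLOCC.isSignedSeparable`). With `V = ∑ sign (u i) • (A i ⊗ B i)`, Bessel and Cauchy–Schwarz give
`|tr V†(K ⊗ M)|² ≤ 4 ‖K ⊗ M‖²` in Hilbert–Schmidt norm. An affine combination of the Choi overlap
with `V` and the trace is therefore at most 1 in absolute value on LOCC, and equals `2 s² - 1` on
the channel of `U`.

It remains to find the decompositions. Rotations have two terms, SWAP and iSWAP four. A Clifford
gate is fixed, up to a unitary on `B`, by the images of `X ⊗ 1` and `Z ⊗ 1`, which leaves four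
classes up to local unitaries: 1, CZ, SWAP, SWAP·CZ. -/

noncomputable section

/-! ### Two-sided multiplication maps -/

/-- The superoperator `X ↦ K X L†`. -/
def sandwich {α β : Type} [Fintype α] (K L : Matrix β α ℂ) : SuperOp α β where
  toFun X := K * X * Lᴴ
  map_add' X Y := by rw [Matrix.mul_add, Matrix.add_mul]
  map_smul' c X := by simp

theorem sandwich_apply {α β : Type} [Fintype α] (K L : Matrix β α ℂ) (X : Matrix α α ℂ) :
    sandwich K L X = K * X * Lᴴ := rfl

theorem unitaryChannel_eq_sandwich {α : Type} [Fintype α] (U : Matrix α α ℂ) :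
    unitaryChannel U = sandwich U U := by
  ext1 X
  simp [unitaryChannel, sandwich_apply, Matrix.mul_assoc]

theorem sandwich_comp {α β γ : Type} [Fintype α] [Fintype β] (K L : Matrix γ β ℂ)
    (K' L' : Matrix β α ℂ) : sandwich K L ∘ₗ sandwich K' L' = sandwich (K * K') (L * L') := by
  ext1 X
  simp [sandwich_apply, Matrix.mul_assoc, Matrix.conjTranspose_mul]

theorem sandwich_one {α : Type} [Fintype α] [DecidableEq α] :
    sandwich (1 : Matrix α α ℂ) 1 = LinearMap.id := by
  ext1 X
  simp [sandwich_apply]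

theorem Matrix.PosSemidef.sandwich_apply {α β : Type} [Fintype α] [Finite β] {X : Matrix α α ℂ}
    (hX : X.PosSemidef) (K : Matrix β α ℂ) : (sandwich K K X).PosSemidef :=
  hX.mul_mul_conjTranspose_same K

/-! ### Tensor products of superoperators and partial traces -/

section TensorOp

variable {m n m' n' m'' n'' : ℕ}

/-- Product operators span, because each matrix unit of the composite system is a Kronecker product
of matrix units. -/
theorem superOp_ext_kronecker {β : Type} {F G : SuperOp (Fin m × Fin n) β}
    (h : ∀ (X : Matrix (Fin m) (Fin m) ℂ) (Y : Matrix (Fin n) (Fin n) ℂ),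
      F (X ⊗ₖ Y) = G (X ⊗ₖ Y)) : F = G := by
  refine LinearMap.ext fun X => ?_
  rw [Matrix.matrix_eq_sum_single X]
  simp only [map_sum]
  refine Finset.sum_congr rfl fun p _ => Finset.sum_congr rfl fun q _ => ?_
  have := h (Matrix.single p.1 q.1 (X p q)) (Matrix.single p.2 q.2 1)
  rwa [Matrix.single_kronecker_single, mul_one] at this

theorem tensorOp_sandwich (K L : Matrix (Fin m') (Fin m) ℂ) (K' L' : Matrix (Fin n') (Fin n) ℂ) :
    tensorOp (sandwich K L) (sandwich K' L') = sandwich (K ⊗ₖ K') (L ⊗ₖ L') :=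
  superOp_ext_kronecker fun X Y => by
    simp only [tensorOp_kronecker, sandwich_apply, Matrix.conjTranspose_kronecker,
      Matrix.mul_kronecker_mul]

theorem tensorOp_comp (Φ : SuperOp (Fin m') (Fin m'')) (Ψ : SuperOp (Fin n') (Fin n''))
    (Φ' : SuperOp (Fin m) (Fin m')) (Ψ' : SuperOp (Fin n) (Fin n')) :
    tensorOp Φ Ψ ∘ₗ tensorOp Φ' Ψ' = tensorOp (Φ ∘ₗ Φ') (Ψ ∘ₗ Ψ') :=
  superOp_ext_kronecker fun X Y => by simp [tensorOp_kronecker]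

/-- The tensor product of superoperators as a bilinear map. -/
def tensorOpBilin (m n m' n' : ℕ) : SuperOp (Fin m) (Fin m') →ₗ[ℂ] SuperOp (Fin n) (Fin n') →ₗ[ℂ]
    SuperOp (Fin m × Fin n) (Fin m' × Fin n') :=
  LinearMap.mk₂ ℂ tensorOp
    (fun _ _ _ => superOp_ext_kronecker fun X Y => by
      simp [tensorOp_kronecker, Matrix.add_kronecker])
    (fun _ _ _ => superOp_ext_kronecker fun X Y => by
      simp [tensorOp_kronecker, Matrix.smul_kronecker])
    (fun _ _ _ => superOp_ext_kronecker fun X Y => by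
      simp [tensorOp_kronecker, Matrix.kronecker_add])
    (fun _ _ _ => superOp_ext_kronecker fun X Y => by
      simp [tensorOp_kronecker, Matrix.kronecker_smul])

theorem tensorOpBilin_apply (Φ : SuperOp (Fin m) (Fin m')) (Ψ : SuperOp (Fin n) (Fin n')) :
    tensorOpBilin m n m' n' Φ Ψ = tensorOp Φ Ψ := rfl

/-- The partial trace over the second system. -/
def traceRight (m n : ℕ) : SuperOp (Fin m × Fin n) (Fin m) where
  toFun X := ∑ b : Fin n, X.submatrix (fun i => (i, b)) (fun i => (i, b))
  map_add' X Y := by simp [Finset.sum_add_distrib, Matrix.submatrix_add]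
  map_smul' c X := by simp [Finset.smul_sum, Matrix.submatrix_smul]

/-- The partial trace over the first system. -/
def traceLeft (m n : ℕ) : SuperOp (Fin m × Fin n) (Fin n) where
  toFun X := ∑ a : Fin m, X.submatrix (fun i => (a, i)) (fun i => (a, i))
  map_add' X Y := by simp [Finset.sum_add_distrib, Matrix.submatrix_add]
  map_smul' c X := by simp [Finset.smul_sum, Matrix.submatrix_smul]

theorem traceRight_apply (X : Matrix (Fin m × Fin n) (Fin m × Fin n) ℂ) :
    traceRight m n X = ∑ b : Fin n, X.submatrix (fun i => (i, b)) (fun i => (i, b)) := rfl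

theorem traceLeft_apply (X : Matrix (Fin m × Fin n) (Fin m × Fin n) ℂ) :
    traceLeft m n X = ∑ a : Fin m, X.submatrix (fun i => (a, i)) (fun i => (a, i)) := rfl

theorem posSemidef_traceRight {X : Matrix (Fin m × Fin n) (Fin m × Fin n) ℂ}
    (hX : X.PosSemidef) : (traceRight m n X).PosSemidef :=
  Matrix.posSemidef_sum _ fun _ _ => hX.submatrix _

theorem posSemidef_traceLeft {X : Matrix (Fin m × Fin n) (Fin m × Fin n) ℂ}
    (hX : X.PosSemidef) : (traceLeft m n X).PosSemidef :=
  Matrix.posSemidef_sum _ fun _ _ => hX.submatrix _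

theorem trace_traceRight (X : Matrix (Fin m × Fin n) (Fin m × Fin n) ℂ) :
    (traceRight m n X).trace = X.trace := by
  simp only [traceRight_apply, Matrix.trace_sum]
  simp only [Matrix.trace, Matrix.diag, Matrix.submatrix_apply, Fintype.sum_prod_type]
  exact Finset.sum_comm

theorem trace_traceLeft (X : Matrix (Fin m × Fin n) (Fin m × Fin n) ℂ) :
    (traceLeft m n X).trace = X.trace := by
  simp only [traceLeft_apply, Matrix.trace_sum]
  simp only [Matrix.trace, Matrix.diag, Matrix.submatrix_apply, Fintype.sum_prod_type]

theorem traceRight_kronecker (X : Matrix (Fin m) (Fin m) ℂ) (Y : Matrix (Fin n) (Fin n) ℂ) :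
    traceRight m n (X ⊗ₖ Y) = Y.trace • X := by
  ext i j
  simp [traceRight_apply, Matrix.sum_apply, Matrix.trace, Finset.mul_sum, mul_comm]

theorem traceLeft_kronecker (X : Matrix (Fin m) (Fin m) ℂ) (Y : Matrix (Fin n) (Fin n) ℂ) :
    traceLeft m n (X ⊗ₖ Y) = X.trace • Y := by
  ext i j
  simp [traceLeft_apply, Matrix.sum_apply, Matrix.trace, Finset.sum_mul]

theorem traceRight_tensorOp (Φ : SuperOp (Fin m) (Fin m'))
    (X : Matrix (Fin m × Fin n) (Fin m × Fin n) ℂ) :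
    traceRight m' n (tensorOp Φ LinearMap.id X) = Φ (traceRight m n X) := by
  refine LinearMap.congr_fun (f := traceRight m' n ∘ₗ tensorOp Φ LinearMap.id)
    (g := Φ ∘ₗ traceRight m n) (superOp_ext_kronecker fun X Y => ?_) X
  simp only [LinearMap.comp_apply, tensorOp_kronecker, traceRight_kronecker, map_smul,
    LinearMap.id_apply]

theorem traceLeft_tensorOp (Ψ : SuperOp (Fin n) (Fin n'))
    (X : Matrix (Fin m × Fin n) (Fin m × Fin n) ℂ) :
    traceLeft m n' (tensorOp LinearMap.id Ψ X) = Ψ (traceLeft m n X) := by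
  refine LinearMap.congr_fun (f := traceLeft m n' ∘ₗ tensorOp LinearMap.id Ψ)
    (g := Ψ ∘ₗ traceLeft m n) (superOp_ext_kronecker fun X Y => ?_) X
  simp only [LinearMap.comp_apply, tensorOp_kronecker, traceLeft_kronecker, map_smul,
    LinearMap.id_apply]

/-- A map that does not increase the trace of positive semidefinite operators. -/
def TraceNonincreasing {α β : Type} [Fintype α] [Fintype β] (Φ : SuperOp α β) : Prop :=
  ∀ X : Matrix α α ℂ, X.PosSemidef → (Φ X).trace.re ≤ X.trace.re

/-- Tracing out the idle system commutes with `Φ` and preserves trace and positivity, so the bound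
is needed only for the reduced operator. -/
theorem TraceNonincreasing.tensorOp_id {Φ : SuperOp (Fin m) (Fin m')}
    (h : TraceNonincreasing Φ) :
    TraceNonincreasing (tensorOp Φ (LinearMap.id : SuperOp (Fin n) (Fin n))) := fun X hX => by
  rw [← trace_traceRight, ← trace_traceRight X, traceRight_tensorOp]
  exact h _ (posSemidef_traceRight hX)

theorem TraceNonincreasing.id_tensorOp {Ψ : SuperOp (Fin n) (Fin n')}
    (h : TraceNonincreasing Ψ) :
    TraceNonincreasing (tensorOp (LinearMap.id : SuperOp (Fin m) (Fin m)) Ψ) := fun X hX => by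
  rw [← trace_traceLeft, ← trace_traceLeft X, traceLeft_tensorOp]
  exact h _ (posSemidef_traceLeft hX)

end TensorOp

/-! ### Completely positive maps and Kraus operators -/

section CompletelyPositive

variable {m n m' n' m'' n'' : ℕ}

theorem IsCP.add {Φ Ψ : SuperOp (Fin m) (Fin n)} (hΦ : IsCP Φ) (hΨ : IsCP Ψ) : IsCP (Φ + Ψ) := by
  intro k X hX
  simp only [← tensorOpBilin_apply, map_add, LinearMap.add_apply]
  exact (hΦ k X hX).add (hΨ k X hX)

theorem isCP_zero : IsCP (0 : SuperOp (Fin m) (Fin n)) := by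
  intro k X hX
  simp only [← tensorOpBilin_apply, map_zero, LinearMap.zero_apply]
  exact Matrix.PosSemidef.zero

theorem isCP_sandwich (K : Matrix (Fin n) (Fin m) ℂ) : IsCP (sandwich K K) := by
  intro k X hX
  rw [← sandwich_one, tensorOp_sandwich]
  exact hX.sandwich_apply _

open scoped MatrixOrder Matrix.Norms.L2Operator in
/-- Choi's theorem: a completely positive map has a Kraus decomposition. -/
theorem IsCP.exists_kraus {Φ : SuperOp (Fin m) (Fin n)} (hΦ : IsCP Φ) :
    ∃ K : Fin m × Fin n → Matrix (Fin n) (Fin m) ℂ, Φ = ∑ k, sandwich (K k) (K k) := by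
  -- The unnormalized maximally entangled vector. Its image under `id ⊗ Φ` is the Choi matrix, and
  -- the rows of a factor `B` with Choi matrix `B† B` become the Kraus operators after conjugation.
  let v : Fin m × Fin m → ℂ := fun p => if p.1 = p.2 then 1 else 0
  obtain ⟨B, hB⟩ := CStarAlgebra.nonneg_iff_eq_star_mul_self.mp
    (hΦ m _ (Matrix.posSemidef_vecMulVec_self_star v)).nonneg
  have key (i j : Fin m) (a b : Fin n) : Φ (Matrix.single i j 1) a b =
      ∑ k, star (B k (i, a)) * B k (j, b) := by
    have := congrFun (congrFun hB (i, a)) (j, b)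
    rw [Matrix.star_eq_conjTranspose, Matrix.mul_apply] at this
    simp only [Matrix.conjTranspose_apply] at this
    rw [← this]
    simp [tensorOp, v, Matrix.vecMulVec_apply, Fintype.sum_prod_type, Matrix.sum_apply,
      Matrix.single_apply, ite_and]
  refine ⟨fun k => Matrix.of fun a i => star (B k (i, a)), ?_⟩
  refine Matrix.ext_linearMap ℂ fun i j => LinearMap.ext fun c => ?_
  ext a b
  have hc : Matrix.single i j c = c • Matrix.single i j (1 : ℂ) := by
    rw [Matrix.smul_single, smul_eq_mul, mul_one]
  simp only [LinearMap.comp_apply, Matrix.singleLinearMap_apply, hc, map_smul, Matrix.smul_apply,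
    key]
  congr 1
  simp [LinearMap.sum_apply, Matrix.sum_apply, sandwich_apply, Matrix.mul_apply,
    Matrix.single_apply, ite_and]

end CompletelyPositive

/-! ### LOCC maps are signed separable -/

section Separable

variable {m n m' n' m'' n'' : ℕ}

/-- The cone of separable maps: sums of maps with product Kraus operators. -/
def separableMaps (m n m' n' : ℕ) : AddSubmonoid (SuperOp (Fin m × Fin n) (Fin m' × Fin n')) :=
  AddSubmonoid.closure {F | ∃ (K : Matrix (Fin m') (Fin m) ℂ) (M : Matrix (Fin n') (Fin n) ℂ),
    F = sandwich (K ⊗ₖ M) (K ⊗ₖ M)}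

theorem tensorOp_mem_separableMaps {Φ : SuperOp (Fin m) (Fin m')} {Ψ : SuperOp (Fin n) (Fin n')}
    (hΦ : IsCP Φ) (hΨ : IsCP Ψ) : tensorOp Φ Ψ ∈ separableMaps m n m' n' := by
  obtain ⟨K, rfl⟩ := hΦ.exists_kraus
  obtain ⟨M, rfl⟩ := hΨ.exists_kraus
  simp only [← tensorOpBilin_apply, map_sum, LinearMap.sum_apply]
  refine sum_mem fun l _ => sum_mem fun k _ => AddSubmonoid.subset_closure ⟨K k, M l, ?_⟩
  rw [tensorOpBilin_apply, tensorOp_sandwich]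

theorem comp_mem_separableMaps {F : SuperOp (Fin m' × Fin n') (Fin m'' × Fin n'')}
    {G : SuperOp (Fin m × Fin n) (Fin m' × Fin n')} (hF : F ∈ separableMaps m' n' m'' n'')
    (hG : G ∈ separableMaps m n m' n') : F ∘ₗ G ∈ separableMaps m n m'' n'' := by
  induction hF using AddSubmonoid.closure_induction with
  | zero => rw [LinearMap.zero_comp]; exact zero_mem _
  | add F F' _ _ h h' => rw [LinearMap.add_comp]; exact add_mem h h'
  | mem F h =>
    obtain ⟨K, M, rfl⟩ := h
    induction hG using AddSubmonoid.closure_induction with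
    | zero => rw [LinearMap.comp_zero]; exact zero_mem _
    | add F F' _ _ h h' => rw [LinearMap.comp_add]; exact add_mem h h'
    | mem G h =>
      obtain ⟨K', M', rfl⟩ := h
      refine AddSubmonoid.subset_closure ⟨K * K', M * M', ?_⟩
      rw [sandwich_comp, Matrix.mul_kronecker_mul]

theorem posSemidef_of_mem_separableMaps {F : SuperOp (Fin m × Fin n) (Fin m' × Fin n')}
    (hF : F ∈ separableMaps m n m' n') {X : Matrix (Fin m × Fin n) (Fin m × Fin n) ℂ}
    (hX : X.PosSemidef) : (F X).PosSemidef := by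
  induction hF using AddSubmonoid.closure_induction with
  | zero => exact Matrix.PosSemidef.zero
  | add F F' _ _ h h' => exact h.add h'
  | mem F h =>
    obtain ⟨K, M, rfl⟩ := h
    exact hX.sandwich_apply _

theorem TraceNonincreasing.comp {F : SuperOp (Fin m' × Fin n') (Fin m'' × Fin n'')}
    {G : SuperOp (Fin m × Fin n) (Fin m' × Fin n')} (hF : TraceNonincreasing F)
    (hG : TraceNonincreasing G) (hG' : G ∈ separableMaps m n m' n') :
    TraceNonincreasing (F ∘ₗ G) := fun X hX =>
  (hF _ (posSemidef_of_mem_separableMaps hG' hX)).trans (hG X hX)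

theorem isCP_id : IsCP (LinearMap.id : SuperOp (Fin m) (Fin m)) := by
  rw [← sandwich_one]
  exact isCP_sandwich 1

/-- A difference of two separable maps whose sum is trace-nonincreasing. -/
def IsSignedSeparable (F : SuperOp (Fin m × Fin n) (Fin m' × Fin n')) : Prop :=
  ∃ P ∈ separableMaps m n m' n', ∃ N ∈ separableMaps m n m' n',
    F = P - N ∧ TraceNonincreasing (P + N)

/-- Signs multiply: `(p - n)(P - N) = (pP + nN) - (pN + nP)`, and the two brackets add up to `(p +
n)(P + N)`. The trace bound for `p k + n k` is applied branch by branch to the positive operator `(P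
k + N k) X`. -/
theorem isSignedSeparable_sum_comp {K : ℕ}
    {F : Fin K → SuperOp (Fin m' × Fin n') (Fin m'' × Fin n'')}
    (hF : ∀ k, IsSignedSeparable (F k)) {P N : Fin K → SuperOp (Fin m × Fin n) (Fin m' × Fin n')}
    (hP : ∀ k, P k ∈ separableMaps m n m' n') (hN : ∀ k, N k ∈ separableMaps m n m' n')
    (hPN : TraceNonincreasing (∑ k, (P k + N k))) :
    IsSignedSeparable (∑ k, F k ∘ₗ (P k - N k)) := by
  choose p hp n hn hF hpn using hF
  refine ⟨∑ k, (p k ∘ₗ P k + n k ∘ₗ N k),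
    sum_mem fun k _ => add_mem (comp_mem_separableMaps (hp k) (hP k))
      (comp_mem_separableMaps (hn k) (hN k)),
    ∑ k, (p k ∘ₗ N k + n k ∘ₗ P k),
    sum_mem fun k _ => add_mem (comp_mem_separableMaps (hp k) (hN k))
      (comp_mem_separableMaps (hn k) (hP k)), ?_, ?_⟩
  · rw [← Finset.sum_sub_distrib]
    refine Finset.sum_congr rfl fun k _ => ?_
    rw [hF, LinearMap.comp_sub, LinearMap.sub_comp, LinearMap.sub_comp]
    abel
  · intro X hX
    refine le_trans ?_ (hPN X hX)
    have : (∑ k, (p k ∘ₗ P k + n k ∘ₗ N k) + ∑ k, (p k ∘ₗ N k + n k ∘ₗ P k)) X =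
        ∑ k, (p k + n k) ((P k + N k) X) := by
      rw [← Finset.sum_add_distrib, LinearMap.sum_apply]
      refine Finset.sum_congr rfl fun k _ => ?_
      simp only [LinearMap.add_apply, LinearMap.comp_apply, map_add]
      abel
    rw [this, LinearMap.sum_apply, Matrix.trace_sum, Matrix.trace_sum, Complex.re_sum,
      Complex.re_sum]
    exact Finset.sum_le_sum fun k _ =>
      hpn k _ (posSemidef_of_mem_separableMaps (add_mem (hP k) (hN k)) hX)

theorem isSignedSeparable_tensorOp {Φ : SuperOp (Fin m) (Fin m')} {Ψ : SuperOp (Fin n) (Fin n')}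
    (hΦ : IsD Φ) (hΨ : IsD Ψ) : IsSignedSeparable (tensorOp Φ Ψ) := by
  obtain ⟨P, N, hP, hN, rfl, hPN⟩ := hΦ
  obtain ⟨P', N', hP', hN', rfl, hPN'⟩ := hΨ
  refine ⟨tensorOp P P' + tensorOp N N', add_mem (tensorOp_mem_separableMaps hP.1 hP'.1)
    (tensorOp_mem_separableMaps hN.1 hN'.1), tensorOp P N' + tensorOp N P',
    add_mem (tensorOp_mem_separableMaps hP.1 hN'.1) (tensorOp_mem_separableMaps hN.1 hP'.1),
    ?_, ?_⟩
  · simp only [← tensorOpBilin_apply, map_sub, LinearMap.sub_apply]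
    abel
  · have : tensorOp P P' + tensorOp N N' + (tensorOp P N' + tensorOp N P') =
        tensorOp (P + N) LinearMap.id ∘ₗ tensorOp LinearMap.id (P' + N') := by
      rw [tensorOp_comp, LinearMap.comp_id, LinearMap.id_comp]
      simp only [← tensorOpBilin_apply, map_add, LinearMap.add_apply]
      abel
    rw [this]
    exact TraceNonincreasing.comp (TraceNonincreasing.tensorOp_id hPN.2)
      (TraceNonincreasing.id_tensorOp hPN'.2) (tensorOp_mem_separableMaps isCP_id hPN'.1)

/-- Induction on the rounds; a round is a signed instrument tensored with the identity, hence a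
family of signed separable branches. This is all that the lower bound uses about LOCC. -/
theorem IsLOCC.isSignedSeparable {a b m n : ℕ} {F : SuperOp (Fin m × Fin n) (Fin a × Fin b)}
    (hF : IsLOCC a b F) : IsSignedSeparable F := by
  induction hF with
  | finish Φ Ψ hΦ hΨ => exact isSignedSeparable_tensorOp hΦ hΨ
  | @roundA m m' n K Φ hΦ F _ ih =>
    obtain ⟨P, N, hP, hN, hΦ, hPN⟩ := hΦ
    have h := isSignedSeparable_sum_comp ih
      (fun k => tensorOp_mem_separableMaps (hP k) isCP_id)
      (fun k => tensorOp_mem_separableMaps (hN k) isCP_id) (by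
        have := TraceNonincreasing.tensorOp_id (n := n) hPN.2
        simpa only [← tensorOpBilin_apply, map_sum, map_add, LinearMap.add_apply,
          LinearMap.sum_apply] using this)
    simpa only [hΦ, ← tensorOpBilin_apply, map_sub, LinearMap.sub_apply] using h
  | @roundB m n n' K Ψ hΨ F _ ih =>
    obtain ⟨P, N, hP, hN, hΨ, hPN⟩ := hΨ
    have h := isSignedSeparable_sum_comp ih
      (fun k => tensorOp_mem_separableMaps isCP_id (hP k))
      (fun k => tensorOp_mem_separableMaps isCP_id (hN k)) (by
        have := TraceNonincreasing.id_tensorOp (m := m) hPN.2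
        simpa only [← tensorOpBilin_apply, map_sum, map_add, LinearMap.add_apply,
          LinearMap.sum_apply] using this)
    simpa only [hΨ, ← tensorOpBilin_apply, map_sub, LinearMap.sub_apply] using h

end Separable

/-! ### The inclusions between the three settings -/

section Inclusions

theorem isCPTN_id {m : ℕ} : IsCPTN (LinearMap.id : SuperOp (Fin m) (Fin m)) :=
  ⟨isCP_id, fun _ _ => le_rfl⟩

theorem isCPTN_zero {m n : ℕ} : IsCPTN (0 : SuperOp (Fin m) (Fin n)) :=
  ⟨isCP_zero, fun X hX => by
    simpa using (Complex.nonneg_iff.mp hX.trace_nonneg).1⟩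

theorem isD_id {m : ℕ} : IsD (LinearMap.id : SuperOp (Fin m) (Fin m)) :=
  ⟨LinearMap.id, 0, isCPTN_id, isCPTN_zero, (sub_zero _).symm, by
    rw [add_zero]; exact isCPTN_id⟩

theorem IsD.isSignedInstrument {m n : ℕ} {Φ : SuperOp (Fin m) (Fin n)} (hΦ : IsD Φ) :
    IsSignedInstrument (fun _ : Fin 1 => Φ) := by
  obtain ⟨P, N, hP, hN, h, hPN⟩ := hΦ
  exact ⟨fun _ => P, fun _ => N, fun _ => hP.1, fun _ => hN.1, fun _ => h, by simpa using hPN⟩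

theorem LO_subset_LOOneWayCC (a b : ℕ) : LO a b ⊆ LOOneWayCC a b := by
  rintro F ⟨Φ, Ψ, hΦ, hΨ, rfl⟩
  exact ⟨1, fun _ => Φ, fun _ => Ψ, hΦ.isSignedInstrument, fun _ => hΨ, by simp⟩

theorem LOOneWayCC_subset_LOCC (a b : ℕ) : LOOneWayCC a b ⊆ LOCC a b := by
  rintro F ⟨K, Φ, Ψ, hΦ, hΨ, rfl⟩
  have := IsLOCC.roundA Φ hΦ (fun k => tensorOp (LinearMap.id : SuperOp (Fin a) (Fin a)) (Ψ k))
    fun k => IsLOCC.finish (a := a) (b := b) LinearMap.id (Ψ k) isD_id (hΨ k)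
  simp only [tensorOp_comp, LinearMap.comp_id, LinearMap.id_comp] at this
  exact this

theorem qpdCosts_mono {α : Type} {S T : Set (SuperOp α α)} (h : S ⊆ T) (E : SuperOp α α) :
    qpdCosts S E ⊆ qpdCosts T E := by
  rintro κ ⟨m, a, F, hm, hF, hE, hκ⟩
  exact ⟨m, a, F, hm, fun i => h (hF i), hE, hκ⟩

/-- More free maps give more decompositions, so attainment passes upwards from LO and the lower
bound downwards from LOCC. -/
theorem isGammaFactor_of_LO_of_LOCC {U : TwoQubitMat} {g : ℝ}
    (hmem : g ∈ qpdCosts (LO 2 2) (unitaryChannel U))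
    (hle : g ∈ lowerBounds (qpdCosts (LOCC 2 2) (unitaryChannel U))) :
    ∀ S ∈ qubitSettings, IsGammaFactor S U g := by
  have h₁ := LO_subset_LOOneWayCC 2 2
  have h₂ := LOOneWayCC_subset_LOCC 2 2
  rintro S (rfl | rfl | rfl)
  · exact ⟨hmem, fun κ hκ => hle (qpdCosts_mono (h₁.trans h₂) _ hκ)⟩
  · exact ⟨qpdCosts_mono h₁ _ hmem, fun κ hκ => hle (qpdCosts_mono h₂ _ hκ)⟩
  · exact ⟨qpdCosts_mono (h₁.trans h₂) _ hmem, hle⟩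

end Inclusions

/-! ### Lower bound by a linear witness -/

section LowerBound

/-- The overlap `⟨V| J(F) |V⟩` of the (unnormalized) Choi operator of `F` with the
vectorization of `V`. -/
def choiOverlap {α : Type} [Fintype α] [DecidableEq α] (V : Matrix α α ℂ) :
    SuperOp α α →ₗ[ℂ] ℂ where
  toFun F := ∑ p, ∑ q, (Vᴴ * F (Matrix.single p q 1) * V) p q
  map_add' F G := by
    simp only [LinearMap.add_apply, Matrix.mul_add, Matrix.add_mul, Matrix.add_apply,
      Finset.sum_add_distrib]
  map_smul' c F := by
    simp only [LinearMap.smul_apply, Matrix.mul_smul, Matrix.smul_mul, Matrix.smul_apply,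
      Finset.smul_sum, RingHom.id_apply]

/-- The Choi operator of `X ↦ K X K†` is the rank-one operator on the vectorization of `K`. -/
theorem choiOverlap_sandwich {α : Type} [Fintype α] [DecidableEq α] (V K : Matrix α α ℂ) :
    choiOverlap V (sandwich K K) = ((‖(Vᴴ * K).trace‖ ^ 2 : ℝ) : ℂ) := by
  have h (p q : α) : (Vᴴ * sandwich K K (Matrix.single p q 1) * V) p q =
      (Vᴴ * K) p p * (Kᴴ * V) q q := by
    have : Vᴴ * sandwich K K (Matrix.single p q 1) * V =
        (Vᴴ * K) * Matrix.single p q 1 * (Kᴴ * V) := by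
      simp only [sandwich_apply, Matrix.mul_assoc]
    rw [this, Matrix.mul_apply, Finset.sum_eq_single q]
    · simp
    · intro b _ hb
      simp [hb]
    · simp
  have hV : Kᴴ * V = (Vᴴ * K)ᴴ := by simp
  change ∑ p, ∑ q, (Vᴴ * sandwich K K (Matrix.single p q 1) * V) p q = _
  simp only [h, ← Finset.mul_sum, ← Finset.sum_mul]
  change (Vᴴ * K).trace * (Kᴴ * V).trace = _
  rw [hV, Matrix.trace_conjTranspose, Complex.ofReal_pow, ← Complex.mul_conj']
  rfl

/-- A family of one-qubit unitaries that is orthogonal in the Hilbert-Schmidt inner product. -/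
structure IsOrthogonalUnitaries {ι : Type} (A : ι → QubitMat) : Prop where
  unitary : ∀ i, A i ∈ Matrix.unitaryGroup (Fin 2) ℂ
  orthogonal : ∀ i j, i ≠ j → ((A i)ᴴ * A j).trace = 0

theorem unitary_conjTranspose_mul {n : Type} [Fintype n] [DecidableEq n] {U : Matrix n n ℂ}
    (hU : U ∈ Matrix.unitaryGroup n ℂ) : Uᴴ * U = 1 :=
  Matrix.mem_unitaryGroup_iff'.mp hU

theorem unitary_mul_conjTranspose {n : Type} [Fintype n] [DecidableEq n] {U : Matrix n n ℂ}
    (hU : U ∈ Matrix.unitaryGroup n ℂ) : U * Uᴴ = 1 :=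
  Matrix.mem_unitaryGroup_iff.mp hU

theorem smul_mem_unitaryGroup {n : Type} [Fintype n] [DecidableEq n] {z : ℂ}
    (hz : star z * z = 1) {M : Matrix n n ℂ} (hM : M ∈ Matrix.unitaryGroup n ℂ) :
    z • M ∈ Matrix.unitaryGroup n ℂ := by
  rw [Matrix.mem_unitaryGroup_iff', star_smul, Matrix.smul_mul, Matrix.mul_smul, smul_smul, hz,
    one_smul]
  exact unitary_conjTranspose_mul hM

variable {ι : Type} [Fintype ι]

/-- A one-qubit unitary has squared Hilbert–Schmidt norm 2, so the `A i / √2` are orthonormal and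
Bessel's inequality applies. -/
theorem IsOrthogonalUnitaries.bessel {A : ι → QubitMat} (hA : IsOrthogonalUnitaries A)
    (K : QubitMat) : ∑ i, ‖((A i)ᴴ * K).trace‖ ^ 2 ≤ 2 * (K * Kᴴ).trace.re := by
  classical
  let v (M : QubitMat) : EuclideanSpace ℂ (Fin 2 × Fin 2) := WithLp.toLp 2 fun p => M p.1 p.2
  have hv (M N : QubitMat) : inner ℂ (v M) (v N) = (Mᴴ * N).trace := by
    simp only [v, PiLp.inner_apply, Matrix.trace, Matrix.diag, Matrix.mul_apply,
      Fintype.sum_prod_type, Matrix.conjTranspose_apply]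
    rw [Finset.sum_comm]
    simp [mul_comm]
  have ho : Orthonormal ℂ fun i => v (((√2 : ℝ) : ℂ)⁻¹ • A i) := by
    rw [orthonormal_iff_ite]
    intro i j
    rw [hv, Matrix.conjTranspose_smul, Matrix.smul_mul, Matrix.mul_smul, Matrix.trace_smul,
      Matrix.trace_smul]
    split_ifs with h
    · subst h
      rw [unitary_conjTranspose_mul (hA.unitary i)]
      simp [← mul_assoc, ← mul_inv, ← Complex.ofReal_mul]
    · rw [hA.orthogonal i j h]
      simp
  have := ho.sum_inner_products_le (v K) (s := Finset.univ)
  have hn : ‖v K‖ ^ 2 = (K * Kᴴ).trace.re := by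
    rw [← inner_self_eq_norm_sq (𝕜 := ℂ), hv, Matrix.trace_mul_comm]
    rfl
  rw [hn] at this
  have h2 (i : ι) : ‖inner ℂ (v (((√2 : ℝ) : ℂ)⁻¹ • A i)) (v K)‖ ^ 2 =
      ‖((A i)ᴴ * K).trace‖ ^ 2 / 2 := by
    rw [hv, Matrix.conjTranspose_smul, Matrix.smul_mul, Matrix.trace_smul, norm_smul, mul_pow]
    simp
    ring
  simp only [h2, ← Finset.sum_div] at this
  linarith

/-- The overlap is a sum of products of local overlaps. Cauchy–Schwarz separates the parties, and
Bessel contributes a factor 2 for each. -/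
theorem norm_trace_mul_kronecker_sq_le {A B : ι → QubitMat} (hA : IsOrthogonalUnitaries A)
    (hB : IsOrthogonalUnitaries B) {c : ι → ℝ} (hc : ∀ i, |c i| ≤ 1) (K M : QubitMat) :
    ‖((∑ i, (c i : ℂ) • (A i ⊗ₖ B i))ᴴ * (K ⊗ₖ M)).trace‖ ^ 2 ≤
      4 * ((K ⊗ₖ M) * (K ⊗ₖ M)ᴴ).trace.re := by
  have h₁ : ((∑ i, (c i : ℂ) • (A i ⊗ₖ B i))ᴴ * (K ⊗ₖ M)).trace =
      ∑ i, (c i : ℂ) * (((A i)ᴴ * K).trace * ((B i)ᴴ * M).trace) := by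
    simp only [Matrix.conjTranspose_sum, Matrix.conjTranspose_smul, Finset.sum_mul,
      Matrix.smul_mul, Matrix.trace_sum, Matrix.trace_smul, Matrix.conjTranspose_kronecker,
      ← Matrix.mul_kronecker_mul, Matrix.trace_kronecker, smul_eq_mul, Complex.star_def,
      Complex.conj_ofReal]
  have hpos (N : QubitMat) : 0 ≤ (N * Nᴴ).trace :=
    (Matrix.posSemidef_self_mul_conjTranspose N).trace_nonneg
  have h₂ : ((K ⊗ₖ M) * (K ⊗ₖ M)ᴴ).trace.re = (K * Kᴴ).trace.re * (M * Mᴴ).trace.re := by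
    rw [Matrix.conjTranspose_kronecker, ← Matrix.mul_kronecker_mul, Matrix.trace_kronecker,
      Complex.mul_re, ← (Complex.nonneg_iff.mp (hpos M)).2]
    ring
  have h₃ : ‖∑ i, (c i : ℂ) * (((A i)ᴴ * K).trace * ((B i)ᴴ * M).trace)‖ ≤
      ∑ i, ‖((A i)ᴴ * K).trace‖ * ‖((B i)ᴴ * M).trace‖ := by
    refine (norm_sum_le _ _).trans (Finset.sum_le_sum fun i _ => ?_)
    rw [norm_mul, norm_mul, Complex.norm_real]
    exact mul_le_of_le_one_left (by positivity) (hc i)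
  rw [h₁, h₂]
  calc _ ≤ (∑ i, ‖((A i)ᴴ * K).trace‖ * ‖((B i)ᴴ * M).trace‖) ^ 2 := by gcongr
    _ ≤ (∑ i, ‖((A i)ᴴ * K).trace‖ ^ 2) * ∑ i, ‖((B i)ᴴ * M).trace‖ ^ 2 :=
      Finset.sum_mul_sq_le_sq_mul_sq _ _ _
    _ ≤ (2 * (K * Kᴴ).trace.re) * (2 * (M * Mᴴ).trace.re) := by
      gcongr
      · exact mul_nonneg zero_le_two (Complex.nonneg_iff.mp (hpos K)).1
      · exact hA.bessel K
      · exact hB.bessel M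
    _ = _ := by ring

/-- For a product Kraus operator `K ⊗ M`, `tr F(1)` is its squared Hilbert–Schmidt norm; both bounds
are additive over the cone. -/
theorem choiOverlap_mem_Icc {A B : ι → QubitMat} (hA : IsOrthogonalUnitaries A)
    (hB : IsOrthogonalUnitaries B) {c : ι → ℝ} (hc : ∀ i, |c i| ≤ 1)
    {F : SuperOp (Fin 2 × Fin 2) (Fin 2 × Fin 2)} (hF : F ∈ separableMaps 2 2 2 2) :
    (choiOverlap (∑ i, (c i : ℂ) • (A i ⊗ₖ B i)) F).re ∈ Set.Icc 0 (4 * (F 1).trace.re) := by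
  induction hF using AddSubmonoid.closure_induction with
  | zero => simp
  | add F G _ _ hF hG =>
    rw [map_add, Complex.add_re, LinearMap.add_apply, Matrix.trace_add, Complex.add_re, mul_add]
    exact ⟨add_nonneg hF.1 hG.1, add_le_add hF.2 hG.2⟩
  | mem F h =>
    obtain ⟨K, M, rfl⟩ := h
    rw [choiOverlap_sandwich, Complex.ofReal_re, sandwich_apply, Matrix.mul_one]
    exact ⟨by positivity, norm_trace_mul_kronecker_sq_le hA hB hc K M⟩

/-- The linear functional `F ↦ ⟨V| J(F) |V⟩ / 8 - tr (F 1) / 4`, which bounds costs from below. -/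
def schmidtWitness (V : TwoQubitMat) (F : SuperOp (Fin 2 × Fin 2) (Fin 2 × Fin 2)) : ℝ :=
  (choiOverlap V F).re / 8 - (F 1).trace.re / 4

/-- On a separable map with `t = tr F(1)` the overlap lies in `[0, 4t]`, so the witness lies in
`[-t/4, t/4]`: the constants 8 and 4 make the interval symmetric. The signs of `P` and `N` then cost
nothing, and the total trace at `1` is at most 4. -/
theorem IsSignedSeparable.abs_schmidtWitness_le {A B : ι → QubitMat}
    (hA : IsOrthogonalUnitaries A) (hB : IsOrthogonalUnitaries B) {c : ι → ℝ}
    (hc : ∀ i, |c i| ≤ 1) {F : SuperOp (Fin 2 × Fin 2) (Fin 2 × Fin 2)}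
    (hF : IsSignedSeparable F) : |schmidtWitness (∑ i, (c i : ℂ) • (A i ⊗ₖ B i)) F| ≤ 1 := by
  obtain ⟨P, hP, N, hN, rfl, hPN⟩ := hF
  have h := hPN 1 Matrix.PosSemidef.one
  have hP := choiOverlap_mem_Icc hA hB hc hP
  have hN := choiOverlap_mem_Icc hA hB hc hN
  have h4 : (1 : TwoQubitMat).trace.re = 4 := by
    rw [Matrix.trace_one]; norm_num
  rw [LinearMap.add_apply, Matrix.trace_add, Complex.add_re, h4] at h
  rw [schmidtWitness, map_sub, Complex.sub_re, LinearMap.sub_apply, Matrix.trace_sub,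
    Complex.sub_re, abs_le]
  constructor <;> linarith [hP.1, hP.2, hN.1, hN.2]

theorem schmidtWitness_sum {κ : Type} [Fintype κ] (V : TwoQubitMat) (a : κ → ℝ)
    (F : κ → SuperOp (Fin 2 × Fin 2) (Fin 2 × Fin 2)) :
    schmidtWitness V (∑ i, (a i : ℂ) • F i) = ∑ i, a i * schmidtWitness V (F i) := by
  simp only [schmidtWitness, map_sum, LinearMap.sum_apply, Matrix.trace_sum, Complex.re_sum,
    map_smul, LinearMap.smul_apply, Matrix.trace_smul, smul_eq_mul, Complex.re_ofReal_mul,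
    Finset.sum_div, ← Finset.sum_sub_distrib]
  exact Finset.sum_congr rfl fun i _ => by ring

/-- Orthogonality gives `tr V†U = 4 ∑ |u i|` and `tr UU† = 4`, so the value is `16 s² / 8 - 1`. -/
theorem schmidtWitness_unitaryChannel {A B : ι → QubitMat} (hA : IsOrthogonalUnitaries A)
    (hB : IsOrthogonalUnitaries B) {u c : ι → ℝ} (hu : ∑ i, u i ^ 2 = 1)
    (hc : ∀ i, c i * u i = |u i|) :
    schmidtWitness (∑ i, (c i : ℂ) • (A i ⊗ₖ B i))
      (unitaryChannel (∑ i, (u i : ℂ) • (A i ⊗ₖ B i))) = 2 * (∑ i, |u i|) ^ 2 - 1 := by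
  classical
  have key (x y : ι → ℝ) : ((∑ i, (x i : ℂ) • (A i ⊗ₖ B i))ᴴ *
      ∑ i, (y i : ℂ) • (A i ⊗ₖ B i)).trace = ((4 * ∑ i, x i * y i : ℝ) : ℂ) := by
    have h (i j : ι) : (((A i ⊗ₖ B i)ᴴ * (A j ⊗ₖ B j)).trace : ℂ) = if i = j then 4 else 0 := by
      rw [Matrix.conjTranspose_kronecker, ← Matrix.mul_kronecker_mul, Matrix.trace_kronecker]
      split_ifs with hij
      · subst hij
        rw [unitary_conjTranspose_mul (hA.unitary i), unitary_conjTranspose_mul (hB.unitary i),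
          Matrix.trace_one]
        norm_num
      · rw [hA.orthogonal i j hij, zero_mul]
    simp only [Matrix.conjTranspose_sum, Matrix.conjTranspose_smul, Finset.sum_mul,
      Finset.mul_sum, Matrix.smul_mul, Matrix.mul_smul, Matrix.trace_sum, Matrix.trace_smul, h,
      smul_eq_mul, Complex.star_def, Complex.conj_ofReal, mul_ite, mul_zero,
      Complex.ofReal_sum, Complex.ofReal_mul, Complex.ofReal_ofNat]
    simp only [Finset.sum_ite_eq', Finset.mem_univ, if_true]
    exact Finset.sum_congr rfl fun i _ => by ring
  rw [schmidtWitness, unitaryChannel_eq_sandwich, choiOverlap_sandwich, key, sandwich_apply,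
    Matrix.mul_one, Matrix.trace_mul_comm, key]
  simp only [← pow_two, hu, hc, Complex.ofReal_re, Complex.norm_real, Real.norm_eq_abs, sq_abs]
  ring

end LowerBound

/-! ### Upper bound by local decompositions -/

section UpperBound

theorem sandwich_smul_left {α β : Type} [Fintype α] (c : ℂ) (K L : Matrix β α ℂ) :
    sandwich (c • K) L = c • sandwich K L := by
  ext1 X
  simp [sandwich_apply]

theorem sandwich_smul_right {α β : Type} [Fintype α] (c : ℂ) (K L : Matrix β α ℂ) :
    sandwich K (c • L) = star c • sandwich K L := by
  ext1 X
  simp [sandwich_apply]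

theorem sandwich_add_left {α β : Type} [Fintype α] (K K' L : Matrix β α ℂ) :
    sandwich (K + K') L = sandwich K L + sandwich K' L := by
  ext1 X
  simp [sandwich_apply, Matrix.add_mul]

theorem sandwich_add_right {α β : Type} [Fintype α] (K L L' : Matrix β α ℂ) :
    sandwich K (L + L') = sandwich K L + sandwich K L' := by
  ext1 X
  simp [sandwich_apply, Matrix.mul_add]

theorem sandwich_sum_smul {α β ι : Type} [Fintype α] [Fintype ι] (u : ι → ℝ)
    (K : ι → Matrix β α ℂ) : sandwich (∑ i, (u i : ℂ) • K i) (∑ i, (u i : ℂ) • K i) =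
      ∑ i, ∑ j, ((u i * u j : ℝ) : ℂ) • sandwich (K i) (K j) := by
  ext1 X
  simp only [sandwich_apply, Matrix.conjTranspose_sum, Matrix.conjTranspose_smul, Matrix.sum_mul,
    Matrix.mul_sum, LinearMap.sum_apply, LinearMap.smul_apply, Matrix.smul_mul, Matrix.mul_smul,
    Complex.star_def, Complex.conj_ofReal, Complex.ofReal_mul, mul_smul]
  rw [Finset.sum_comm]
  simp only [Finset.smul_sum]
  exact Finset.sum_congr rfl fun i _ => Finset.sum_congr rfl fun j _ => smul_comm _ _ _

/-- The map `X ↦ (A X B† + B X A†) / 2`. -/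
def crossMap (A B : QubitMat) : SuperOp (Fin 2) (Fin 2) :=
  (1 / 2 : ℂ) • (sandwich A B + sandwich B A)

/-- Polarization: with `K = (A + B)/2` and `L = (A - B)/2`, the difference of the two Kraus maps is
the cross map, and their sum is the average of two unitary channels, which preserves the trace. -/
theorem isD_crossMap {A B : QubitMat} (hA : A ∈ Matrix.unitaryGroup (Fin 2) ℂ)
    (hB : B ∈ Matrix.unitaryGroup (Fin 2) ℂ) : IsD (crossMap A B) := by
  have htr {U : QubitMat} (hU : U ∈ Matrix.unitaryGroup (Fin 2) ℂ) (X : QubitMat) :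
      (sandwich U U X).trace = X.trace := by
    rw [sandwich_apply, Matrix.trace_mul_cycle, unitary_conjTranspose_mul hU, Matrix.one_mul]
  let K : QubitMat := (1 / 2 : ℂ) • (A + B)
  let L : QubitMat := (1 / 2 : ℂ) • (A + (-1 : ℂ) • B)
  have hadd : sandwich K K + sandwich L L = (1 / 2 : ℂ) • (sandwich A A + sandwich B B) := by
    simp only [K, L, sandwich_smul_left, sandwich_smul_right, sandwich_add_left,
      sandwich_add_right, Complex.star_def, map_div₀, map_one, map_ofNat, map_neg]
    module
  have hsub : crossMap A B = sandwich K K - sandwich L L := by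
    simp only [crossMap, K, L, sandwich_smul_left, sandwich_smul_right, sandwich_add_left,
      sandwich_add_right, Complex.star_def, map_div₀, map_one, map_ofNat, map_neg]
    module
  have hsum (X : QubitMat) : (sandwich K K X).trace + (sandwich L L X).trace = X.trace := by
    rw [← Matrix.trace_add, ← LinearMap.add_apply, hadd, LinearMap.smul_apply,
      LinearMap.add_apply, Matrix.trace_smul, Matrix.trace_add, htr hA, htr hB, smul_eq_mul]
    ring
  have hpos (M : QubitMat) {X : QubitMat} (hX : X.PosSemidef) : 0 ≤ (sandwich M M X).trace.re :=
    (Complex.nonneg_iff.mp (hX.sandwich_apply M).trace_nonneg).1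
  refine ⟨sandwich K K, sandwich L L, ⟨isCP_sandwich K, fun X hX => ?_⟩,
    ⟨isCP_sandwich L, fun X hX => ?_⟩, hsub,
    (isCP_sandwich K).add (isCP_sandwich L), fun X hX => ?_⟩
  · rw [← hsum X, Complex.add_re]
    linarith [hpos L hX]
  · rw [← hsum X, Complex.add_re]
    linarith [hpos K hX]
  · rw [LinearMap.add_apply, Matrix.trace_add, hsum]

/-- `crossMap A A'` acts as the real part of `sandwich A A'` and `crossMap A (iA')` as its imaginary
part; `-i` on the second factor supplies the minus sign in `Re (zw) = Re z Re w - Im z Im w`. -/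
theorem tensorOp_crossMap_add (A A' B B' : QubitMat) :
    tensorOp (crossMap A A') (crossMap B B') +
      tensorOp (crossMap A (Complex.I • A')) (crossMap B (-Complex.I • B')) =
    (1 / 2 : ℂ) • (sandwich (A ⊗ₖ B) (A' ⊗ₖ B') + sandwich (A' ⊗ₖ B') (A ⊗ₖ B)) := by
  simp only [crossMap, sandwich_smul_left, sandwich_smul_right, ← tensorOpBilin_apply, map_add,
    map_smul, LinearMap.add_apply, LinearMap.smul_apply]
  simp only [tensorOpBilin_apply, tensorOp_sandwich, star_neg, Complex.star_def, Complex.conj_I,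
    smul_add, smul_smul, neg_neg, neg_mul, neg_smul]
  match_scalars <;>
    first
    | linear_combination (-1 / 4 : ℂ) * Complex.I_mul_I
    | linear_combination (1 / 4 : ℂ) * Complex.I_mul_I

theorem mem_qpdCosts_of_fintype {α κ : Type} [Fintype κ] [Nonempty κ] {S : Set (SuperOp α α)}
    {E : SuperOp α α} (a : κ → ℝ) (F : κ → SuperOp α α) (hF : ∀ i, F i ∈ S)
    (hE : E = ∑ i, (a i : ℂ) • F i) : ∑ i, |a i| ∈ qpdCosts S E := by
  let e := (Fintype.equivFin κ).symm
  refine ⟨Fintype.card κ, a ∘ e, F ∘ e, Fintype.card_pos, fun i => hF _, ?_, ?_⟩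
  · rw [hE]
    exact (e.sum_comp fun i => (a i : ℂ) • F i).symm
  · exact (e.sum_comp fun i => |a i|).symm

variable {ι : Type} [Fintype ι]

theorem mem_qpdCosts_LO {A B : ι → QubitMat}
    (hA : ∀ i, A i ∈ Matrix.unitaryGroup (Fin 2) ℂ)
    (hB : ∀ i, B i ∈ Matrix.unitaryGroup (Fin 2) ℂ) {u : ι → ℝ} (hu : ∑ i, u i ^ 2 = 1) :
    2 * (∑ i, |u i|) ^ 2 - 1 ∈
      qpdCosts (LO 2 2) (unitaryChannel (∑ i, (u i : ℂ) • (A i ⊗ₖ B i))) := by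
  classical
  have : Nonempty ι := by
    by_contra h
    rw [not_nonempty_iff] at h
    simp at hu
  -- The Boolean selects the imaginary part. That map vanishes for `i = j`, and giving it weight 0
  -- there saves `∑ u i ^ 2 = 1` of the cost `2 s²`.
  let a : (ι × ι) × Bool → ℝ := fun p =>
    if p.2 && decide (p.1.1 = p.1.2) then 0 else u p.1.1 * u p.1.2
  let F : (ι × ι) × Bool → SuperOp (Fin 2 × Fin 2) (Fin 2 × Fin 2) := fun p =>
    if p.2 then tensorOp (crossMap (A p.1.1) (Complex.I • A p.1.2))
        (crossMap (B p.1.1) (-Complex.I • B p.1.2))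
      else tensorOp (crossMap (A p.1.1) (A p.1.2)) (crossMap (B p.1.1) (B p.1.2))
  have hcost : ∑ p, |a p| = 2 * (∑ i, |u i|) ^ 2 - 1 := by
    rw [← hu, pow_two (∑ i, |u i|), Finset.sum_mul_sum, Fintype.sum_prod_type,
      Fintype.sum_prod_type]
    simp only [Finset.mul_sum, ← Finset.sum_sub_distrib, Fintype.sum_bool]
    refine Finset.sum_congr rfl fun i _ => ?_
    have h2 : u i ^ 2 = ∑ j, if i = j then u i ^ 2 else 0 := by simp
    rw [h2, ← Finset.sum_sub_distrib]
    refine Finset.sum_congr rfl fun j _ => ?_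
    by_cases h : i = j
    · subst h
      simp [a, ← pow_two]
      ring
    · simp [a, h, abs_mul]
      ring
  rw [← hcost]
  refine mem_qpdCosts_of_fintype a F (fun p => ?_) ?_
  · by_cases hp : p.2
    · refine ⟨_, _,
        isD_crossMap (hA p.1.1) (smul_mem_unitaryGroup (z := Complex.I) (by simp) (hA p.1.2)),
        isD_crossMap (hB p.1.1) (smul_mem_unitaryGroup (z := -Complex.I) (by simp) (hB p.1.2)), ?_⟩
      simp only [F, hp, if_true]
    · refine ⟨_, _, isD_crossMap (hA p.1.1) (hA p.1.2), isD_crossMap (hB p.1.1) (hB p.1.2), ?_⟩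
      simp only [F, hp, Bool.false_eq_true, if_false]
  · have hterm (i j : ι) : ∑ b, (a ((i, j), b) : ℂ) • F ((i, j), b) =
        ((u i * u j : ℝ) : ℂ) • (1 / 2 : ℂ) • (sandwich (A i ⊗ₖ B i) (A j ⊗ₖ B j) +
          sandwich (A j ⊗ₖ B j) (A i ⊗ₖ B i)) := by
      rw [← tensorOp_crossMap_add, Fintype.sum_bool]
      by_cases h : i = j
      · subst h
        have h0 : crossMap (A i) (Complex.I • A i) = 0 := by
          simp only [crossMap, sandwich_smul_left, sandwich_smul_right, Complex.star_def,
            Complex.conj_I]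
          module
        simp [a, F, h0, ← tensorOpBilin_apply]
      · simp [a, F, h, smul_add, add_comm]
    rw [Fintype.sum_prod_type, Fintype.sum_prod_type]
    simp only [hterm]
    rw [unitaryChannel_eq_sandwich, sandwich_sum_smul]
    have hswap : ∑ i, ∑ j, ((u i * u j : ℝ) : ℂ) • sandwich (A j ⊗ₖ B j) (A i ⊗ₖ B i) =
        ∑ i, ∑ j, ((u i * u j : ℝ) : ℂ) • sandwich (A i ⊗ₖ B i) (A j ⊗ₖ B j) := by
      rw [Finset.sum_comm]
      simp only [mul_comm]
    simp only [smul_comm _ (1 / 2 : ℂ), smul_add, Finset.sum_add_distrib, ← Finset.smul_sum,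
      hswap]
    module

end UpperBound

/-! ### The γ-factor from a unitary Schmidt decomposition -/

section SchmidtDecomposition

/-- `U` has an operator Schmidt decomposition into local unitaries, with (real) coefficients of
absolute sum `s`. -/
def HasUnitarySchmidt (U : TwoQubitMat) (s : ℝ) : Prop :=
  ∃ (r : ℕ) (u : Fin r → ℝ) (A B : Fin r → QubitMat), IsOrthogonalUnitaries A ∧
    IsOrthogonalUnitaries B ∧ ∑ i, u i ^ 2 = 1 ∧ ∑ i, |u i| = s ∧
    U = ∑ i, (u i : ℂ) • (A i ⊗ₖ B i)

theorem HasUnitarySchmidt.isGammaFactor {U : TwoQubitMat} {s : ℝ} (h : HasUnitarySchmidt U s) :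
    ∀ S ∈ qubitSettings, IsGammaFactor S U (2 * s ^ 2 - 1) := by
  obtain ⟨r, u, A, B, hA, hB, hu, rfl, rfl⟩ := h
  refine isGammaFactor_of_LO_of_LOCC (mem_qpdCosts_LO hA.unitary hB.unitary hu) ?_
  rintro κ ⟨m, a, F, -, hF, hE, rfl⟩
  -- The signs of the coefficients, which maximize the overlap with `U`; the choice at `u i = 0` is
  -- immaterial.
  let c : Fin r → ℝ := fun i => if 0 ≤ u i then 1 else -1
  have hc (i) : |c i| ≤ 1 := by
    simp only [c]; split_ifs <;> simp
  have hcu (i) : c i * u i = |u i| := by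
    simp only [c]
    split_ifs with h
    · rw [one_mul, abs_of_nonneg h]
    · rw [neg_one_mul, abs_of_neg (not_le.mp h)]
  rw [← schmidtWitness_unitaryChannel hA hB hu hcu, hE, schmidtWitness_sum]
  refine (le_abs_self _).trans ((Finset.abs_sum_le_sum_abs _ _).trans
    (Finset.sum_le_sum fun i _ => ?_))
  rw [abs_mul]
  exact mul_le_of_le_one_right (abs_nonneg _)
    ((IsLOCC.isSignedSeparable (hF i)).abs_schmidtWitness_le hA hB hc)

theorem IsOrthogonalUnitaries.mul_left {ι : Type} {A : ι → QubitMat}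
    (hA : IsOrthogonalUnitaries A) {L : QubitMat} (hL : L ∈ Matrix.unitaryGroup (Fin 2) ℂ) :
    IsOrthogonalUnitaries fun i => L * A i where
  unitary i := mul_mem hL (hA.unitary i)
  orthogonal i j hij := by
    rw [Matrix.conjTranspose_mul, Matrix.mul_assoc, ← Matrix.mul_assoc Lᴴ,
      unitary_conjTranspose_mul hL, Matrix.one_mul, hA.orthogonal i j hij]

theorem IsOrthogonalUnitaries.mul_right {ι : Type} {A : ι → QubitMat}
    (hA : IsOrthogonalUnitaries A) {R : QubitMat} (hR : R ∈ Matrix.unitaryGroup (Fin 2) ℂ) :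
    IsOrthogonalUnitaries fun i => A i * R where
  unitary i := mul_mem (hA.unitary i) hR
  orthogonal i j hij := by
    rw [Matrix.conjTranspose_mul, ← Matrix.mul_assoc, Matrix.trace_mul_comm, Matrix.mul_assoc,
      ← Matrix.mul_assoc, ← Matrix.mul_assoc, unitary_mul_conjTranspose hR, Matrix.one_mul,
      hA.orthogonal i j hij]

/-- Local unitaries are absorbed into the factors and leave the coefficients alone, so only local
equivalence classes matter. -/
theorem HasUnitarySchmidt.local_mul_mul {U : TwoQubitMat} {s : ℝ} (h : HasUnitarySchmidt U s)
    {L M R W : QubitMat} (hL : L ∈ Matrix.unitaryGroup (Fin 2) ℂ)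
    (hM : M ∈ Matrix.unitaryGroup (Fin 2) ℂ) (hR : R ∈ Matrix.unitaryGroup (Fin 2) ℂ)
    (hW : W ∈ Matrix.unitaryGroup (Fin 2) ℂ) :
    HasUnitarySchmidt ((L ⊗ₖ M) * U * (R ⊗ₖ W)) s := by
  obtain ⟨r, u, A, B, hA, hB, hu, hs, rfl⟩ := h
  refine ⟨r, u, fun i => L * A i * R, fun i => M * B i * W, (hA.mul_left hL).mul_right hR,
    (hB.mul_left hM).mul_right hW, hu, hs, ?_⟩
  simp only [Finset.mul_sum, Finset.sum_mul, Matrix.mul_smul, Matrix.smul_mul,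
    Matrix.mul_kronecker_mul]

end SchmidtDecomposition

/-! ### Schmidt decompositions of the gates -/

section Gates

theorem HasUnitarySchmidt.of_pair {U : TwoQubitMat} {c s : ℝ} {A A' B B' : QubitMat}
    (hA : A ∈ Matrix.unitaryGroup (Fin 2) ℂ) (hA' : A' ∈ Matrix.unitaryGroup (Fin 2) ℂ)
    (hB : B ∈ Matrix.unitaryGroup (Fin 2) ℂ) (hB' : B' ∈ Matrix.unitaryGroup (Fin 2) ℂ)
    (hAA' : (Aᴴ * A').trace = 0) (hBB' : (Bᴴ * B').trace = 0) (hcs : c ^ 2 + s ^ 2 = 1)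
    (hU : U = (c : ℂ) • (A ⊗ₖ B) + (s : ℂ) • (A' ⊗ₖ B')) :
    HasUnitarySchmidt U (|c| + |s|) := by
  have symm {M N : QubitMat} (h : (Mᴴ * N).trace = 0) : (Nᴴ * M).trace = 0 := by
    have := congrArg star h
    rwa [← Matrix.trace_conjTranspose, Matrix.conjTranspose_mul,
      Matrix.conjTranspose_conjTranspose, star_zero] at this
  have key {M N : QubitMat} (hM : M ∈ Matrix.unitaryGroup (Fin 2) ℂ)
      (hN : N ∈ Matrix.unitaryGroup (Fin 2) ℂ) (h : (Mᴴ * N).trace = 0) :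
      IsOrthogonalUnitaries ![M, N] := by
    refine ⟨fun i => ?_, fun i j hij => ?_⟩
    · fin_cases i
      exacts [hM, hN]
    · fin_cases i <;> fin_cases j
      exacts [absurd rfl hij, h, symm h, absurd rfl hij]
  refine ⟨2, ![c, s], ![A, A'], ![B, B'], key hA hA' hAA', key hB hB' hBB', ?_, ?_, ?_⟩
  · simpa using hcs
  · simp
  · simpa using hU

/-- An involution has spectral projections `(1 ± M)/2`, so the exponential series splits into the
scalar series at the two eigenvalues. -/
theorem exp_smul_of_mul_self_eq_one {n : Type} [Fintype n] [DecidableEq n] {M : Matrix n n ℂ}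
    (hM : M * M = 1) (x : ℝ) : NormedSpace.exp ((-Complex.I * (x : ℂ)) • M) =
      (Real.cos x : ℂ) • (1 : Matrix n n ℂ) - (Complex.I * Real.sin x) • M := by
  have hpow (k : ℕ) : M ^ k = (1 / 2 : ℂ) • (1 + M) + ((-1) ^ k : ℂ) • (1 / 2 : ℂ) • (1 - M) := by
    induction k with
    | zero => rw [pow_zero, pow_zero]; module
    | succ k ih =>
      rw [pow_succ, ih, Matrix.add_mul, Matrix.smul_mul, Matrix.smul_mul, Matrix.smul_mul,
        Matrix.add_mul, Matrix.sub_mul, hM, Matrix.one_mul, pow_succ]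
      module
  have hexp (c : ℂ) : HasSum (fun k : ℕ => ((k.factorial : ℂ)⁻¹ * c ^ k)) (Complex.exp c) := by
    simpa [Complex.exp_eq_exp_ℂ] using NormedSpace.exp_series_hasSum_exp' (𝕂 := ℂ) c
  have hsum (c : ℂ) : HasSum (fun k : ℕ => ((k.factorial : ℂ)⁻¹) • (c • M) ^ k)
      (Complex.exp c • (1 / 2 : ℂ) • (1 + M) + Complex.exp (-c) • (1 / 2 : ℂ) • (1 - M)) := by
    have h := ((hexp c).smul_const ((1 / 2 : ℂ) • (1 + M))).add
      ((hexp (-c)).smul_const ((1 / 2 : ℂ) • (1 - M)))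
    convert h using 2 with k
    rw [smul_pow, hpow, neg_pow]
    module
  rw [NormedSpace.exp_eq_tsum ℂ]
  change (∑' k : ℕ, ((k.factorial : ℂ)⁻¹) • ((-Complex.I * (x : ℂ)) • M) ^ k) = _
  rw [(hsum _).tsum_eq]
  have h₁ : Complex.exp (-Complex.I * x) = Real.cos x - Complex.I * Real.sin x := by
    rw [show -Complex.I * (x : ℂ) = (-x : ℂ) * Complex.I by ring, Complex.exp_mul_I,
      Complex.cos_neg, Complex.sin_neg, Complex.ofReal_cos, Complex.ofReal_sin]
    ring
  have h₂ : Complex.exp (-(-Complex.I * x)) = Real.cos x + Complex.I * Real.sin x := by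
    rw [show -(-Complex.I * (x : ℂ)) = (x : ℂ) * Complex.I by ring, Complex.exp_mul_I,
      Complex.ofReal_cos, Complex.ofReal_sin]
    ring
  rw [h₁, h₂]
  module

theorem conjTranspose_pauliX : pauliXᴴ = pauliX := by
  ext i j; fin_cases i <;> fin_cases j <;> simp [pauliX]

theorem conjTranspose_pauliY : pauliYᴴ = pauliY := by
  ext i j; fin_cases i <;> fin_cases j <;> simp [pauliY]

theorem conjTranspose_pauliZ : pauliZᴴ = pauliZ := by
  ext i j; fin_cases i <;> fin_cases j <;> simp [pauliZ]

theorem pauliX_mul_self : pauliX * pauliX = 1 := by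
  ext i j; fin_cases i <;> fin_cases j <;> simp [pauliX]

theorem pauliY_mul_self : pauliY * pauliY = 1 := by
  ext i j; fin_cases i <;> fin_cases j <;> simp [pauliY]

theorem pauliZ_mul_self : pauliZ * pauliZ = 1 := by
  ext i j; fin_cases i <;> fin_cases j <;> simp [pauliZ]

/-- The non-identity Pauli matrices are traceless Hermitian involutions. -/
theorem pauli_properties {σ : QubitMat} (hσ : σ ∈ ({pauliX, pauliY, pauliZ} : Set QubitMat)) :
    σᴴ = σ ∧ σ * σ = 1 ∧ σ.trace = 0 := by
  rcases hσ with rfl | rfl | rfl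
  · exact ⟨conjTranspose_pauliX, pauliX_mul_self, by simp [pauliX, Matrix.trace_fin_two]⟩
  · exact ⟨conjTranspose_pauliY, pauliY_mul_self, by simp [pauliY, Matrix.trace_fin_two]⟩
  · exact ⟨conjTranspose_pauliZ, pauliZ_mul_self, by simp [pauliZ, Matrix.trace_fin_two]⟩

theorem mem_unitaryGroup_of_involution {n : Type} [Fintype n] [DecidableEq n]
    {M : Matrix n n ℂ} (h : Mᴴ = M) (h' : M * M = 1) : M ∈ Matrix.unitaryGroup n ℂ := by
  rw [Matrix.mem_unitaryGroup_iff, Matrix.star_eq_conjTranspose, h, h']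

theorem two_mul_abs_add_abs_sq {c s : ℝ} (h : c ^ 2 + s ^ 2 = 1) :
    2 * (|c| + |s|) ^ 2 - 1 = 1 + 2 * |2 * s * c| := by
  rw [abs_mul, abs_mul, abs_two]
  nlinarith [sq_abs c, sq_abs s]

/-- A controlled `V` is `1 ⊗ (1 + V)/2 + Z ⊗ (1 - V)/2`. For `V = R²`, with `R` the rotation by
`θ/2`, one has `1 + R² = R(R† + R) = 2cR` and `1 - R² = R(R† - R) = 2is Rσ`, which leaves two
orthogonal unitary terms. -/
theorem hasUnitarySchmidt_gateCR {σ : QubitMat}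
    (hσ : σ ∈ ({pauliX, pauliY, pauliZ} : Set QubitMat)) (θ : ℝ) :
    HasUnitarySchmidt (gateCR σ θ) (|Real.cos (θ / 4)| + |Real.sin (θ / 4)|) := by
  obtain ⟨hσ₁, hσ₂, hσ₃⟩ := pauli_properties hσ
  set c := Real.cos (θ / 4) with hc
  set s := Real.sin (θ / 4) with hs
  have hcs : c ^ 2 + s ^ 2 = 1 := Real.cos_sq_add_sin_sq _
  have hcs' : (c : ℂ) ^ 2 + (s : ℂ) ^ 2 = 1 := by exact_mod_cast hcs
  let R : QubitMat := (c : ℂ) • 1 - (Complex.I * s) • σ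
  have hRstar : Rᴴ = (c : ℂ) • 1 + (Complex.I * s) • σ := by
    simp only [R, Matrix.conjTranspose_sub, Matrix.conjTranspose_smul, Matrix.conjTranspose_one,
      hσ₁, Complex.star_def, map_mul, Complex.conj_ofReal, Complex.conj_I]
    module
  have hRR : Rᴴ * R = 1 := by
    rw [hRstar]
    simp only [R, Matrix.add_mul, Matrix.mul_sub, Matrix.smul_mul, Matrix.mul_smul,
      Matrix.one_mul, Matrix.mul_one, hσ₂]
    match_scalars
    · linear_combination hcs' - (s : ℂ) ^ 2 * Complex.I_mul_I
    · ring
  have hR : R ∈ Matrix.unitaryGroup (Fin 2) ℂ := Matrix.mem_unitaryGroup_iff'.mpr hRR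
  have hZ := mem_unitaryGroup_of_involution conjTranspose_pauliZ pauliZ_mul_self
  have hrot : rot σ θ = ((c : ℂ) ^ 2 - (s : ℂ) ^ 2) • 1 - (2 * Complex.I * s * c) • σ := by
    have h := exp_smul_of_mul_self_eq_one hσ₂ (θ / 2)
    rw [show θ / 2 = 2 * (θ / 4) by ring, Real.cos_two_mul', Real.sin_two_mul, ← hc, ← hs] at h
    rw [rot, show (θ : ℂ) / 2 = ((2 * (θ / 4) : ℝ) : ℂ) by push_cast; ring, h]
    push_cast
    congr 2
    ring
  have hcontrol (V : QubitMat) : controlled V =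
      (1 / 2 : ℂ) • ((1 : QubitMat) ⊗ₖ (1 + V)) + (1 / 2 : ℂ) • (pauliZ ⊗ₖ (1 - V)) := by
    have h0 : Matrix.single 0 0 1 = (1 / 2 : ℂ) • (1 + pauliZ) := by
      ext i j; fin_cases i <;> fin_cases j <;> norm_num [pauliZ]
    have h1 : Matrix.single 1 1 1 = (1 / 2 : ℂ) • (1 - pauliZ) := by
      ext i j; fin_cases i <;> fin_cases j <;> norm_num [pauliZ]
    rw [controlled, h0, h1, sub_eq_add_neg, sub_eq_add_neg, ← neg_one_smul ℂ pauliZ,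
      ← neg_one_smul ℂ V]
    simp only [Matrix.smul_kronecker, Matrix.add_kronecker, Matrix.kronecker_add,
      Matrix.kronecker_smul]
    module
  refine HasUnitarySchmidt.of_pair (A := 1) (A' := Complex.I • pauliZ) (B := R) (B' := R * σ)
    (one_mem _) (smul_mem_unitaryGroup (by simp) hZ) hR
    (mul_mem hR (mem_unitaryGroup_of_involution hσ₁ hσ₂)) ?_ ?_ hcs ?_
  · simp [pauliZ, Matrix.trace_fin_two]
  · rw [← Matrix.mul_assoc, hRR, Matrix.one_mul, hσ₃]
  · have h₁ : 1 + rot σ θ = (2 * c : ℂ) • R := by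
      rw [hrot]
      simp only [R]
      match_scalars
      · linear_combination -hcs'
      · ring
    have h₂ : 1 - rot σ θ = (2 * Complex.I * s : ℂ) • (R * σ) := by
      rw [hrot]
      simp only [R, Matrix.sub_mul, Matrix.smul_mul, Matrix.one_mul, hσ₂]
      match_scalars
      · linear_combination -hcs' + 2 * (s : ℂ) ^ 2 * Complex.I_mul_I
      · ring
    rw [gateCR, hcontrol, h₁, h₂]
    simp only [Matrix.kronecker_smul, Matrix.smul_kronecker]
    module

theorem hasUnitarySchmidt_gateRR {σ : QubitMat}
    (hσ : σ ∈ ({pauliX, pauliY, pauliZ} : Set QubitMat)) (θ : ℝ) :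
    HasUnitarySchmidt (gateRR σ θ) (|Real.cos (θ / 2)| + |Real.sin (θ / 2)|) := by
  obtain ⟨hσ₁, hσ₂, hσ₃⟩ := pauli_properties hσ
  have hσu := mem_unitaryGroup_of_involution hσ₁ hσ₂
  refine HasUnitarySchmidt.of_pair (A := 1) (A' := -Complex.I • σ) (B := 1) (B' := σ)
    (one_mem _) (smul_mem_unitaryGroup (by simp) hσu) (one_mem _) hσu ?_ ?_
    (Real.cos_sq_add_sin_sq _) ?_
  · simp [hσ₃]
  · simp [hσ₃]
  · have h := exp_smul_of_mul_self_eq_one (M := σ ⊗ₖ σ)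
      (by rw [← Matrix.mul_kronecker_mul, hσ₂, Matrix.one_kronecker_one]) (θ / 2)
    rw [gateRR, show (θ : ℂ) / 2 = ((θ / 2 : ℝ) : ℂ) by push_cast; ring, h,
      Matrix.one_kronecker_one, Matrix.smul_kronecker]
    module

/-- The phase gate `diag(1, z)`. -/
def phaseGate (z : ℂ) : QubitMat := !![1, 0; 0, z]

theorem phaseGate_mem_unitaryGroup {z : ℂ} (hz : z * star z = 1) :
    phaseGate z ∈ Matrix.unitaryGroup (Fin 2) ℂ := by
  rw [Matrix.mem_unitaryGroup_iff]
  ext i j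
  fin_cases i <;> fin_cases j <;> simp [phaseGate, Matrix.mul_apply, Matrix.star_apply]
  simpa using hz

/-- Since `R_σ(π) = -iσ`, the phase gate `diag(1, i)` on the control turns the controlled rotation
by `π` into the controlled `σ`. -/
theorem hasUnitarySchmidt_controlled {σ : QubitMat}
    (hσ : σ ∈ ({pauliX, pauliY, pauliZ} : Set QubitMat)) :
    HasUnitarySchmidt (controlled σ) (|Real.cos (Real.pi / 4)| + |Real.sin (Real.pi / 4)|) := by
  have h := (hasUnitarySchmidt_gateCR hσ Real.pi).local_mul_mul
    (phaseGate_mem_unitaryGroup (z := Complex.I) (by simp)) (one_mem _) (one_mem _) (one_mem _)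
  have hr : rot σ Real.pi = -Complex.I • σ := by
    have := exp_smul_of_mul_self_eq_one (pauli_properties hσ).2.1 (Real.pi / 2)
    rw [rot, show (Real.pi : ℂ) / 2 = ((Real.pi / 2 : ℝ) : ℂ) by push_cast; ring, this]
    simp
  have hs : phaseGate Complex.I * Matrix.single 0 0 1 = Matrix.single 0 0 1 := by
    ext i j; fin_cases i <;> fin_cases j <;> simp [phaseGate, Matrix.mul_apply]
  have hs' : phaseGate Complex.I * Matrix.single 1 1 1 = Complex.I • Matrix.single 1 1 1 := by
    ext i j; fin_cases i <;> fin_cases j <;> simp [phaseGate, Matrix.mul_apply]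
  have hU : controlled σ = (phaseGate Complex.I ⊗ₖ 1) * gateCR σ Real.pi * (1 ⊗ₖ 1) := by
    rw [Matrix.one_kronecker_one, Matrix.mul_one, gateCR, hr, controlled, controlled,
      Matrix.mul_add, ← Matrix.mul_kronecker_mul, ← Matrix.mul_kronecker_mul, hs, hs',
      Matrix.one_mul, Matrix.one_mul, Matrix.smul_kronecker, Matrix.kronecker_smul, smul_smul]
    simp
  rwa [hU]

theorem isOrthogonalUnitaries_pauli : IsOrthogonalUnitaries ![1, pauliX, pauliY, pauliZ] := by
  refine ⟨fun i => ?_, fun i j hij => ?_⟩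
  · fin_cases i
    exacts [one_mem _, mem_unitaryGroup_of_involution conjTranspose_pauliX pauliX_mul_self,
      mem_unitaryGroup_of_involution conjTranspose_pauliY pauliY_mul_self,
      mem_unitaryGroup_of_involution conjTranspose_pauliZ pauliZ_mul_self]
  · fin_cases i <;> fin_cases j <;>
      first
      | exact absurd rfl hij
      | simp [pauliX, pauliY, pauliZ, Matrix.trace_fin_two, Matrix.mul_apply]

/-- The phases are absorbed into the factors on `A`, leaving four coefficients `1/2`. -/
theorem hasUnitarySchmidt_of_pauli_sum {U : TwoQubitMat} (z : Fin 4 → ℂ)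
    (hz : ∀ i, star (z i) * z i = 1) (hU : U = (1 / 2 : ℂ) • (z 0 • ((1 : QubitMat) ⊗ₖ 1) +
      z 1 • (pauliX ⊗ₖ pauliX) + z 2 • (pauliY ⊗ₖ pauliY) + z 3 • (pauliZ ⊗ₖ pauliZ))) :
    HasUnitarySchmidt U 2 := by
  have h := isOrthogonalUnitaries_pauli
  refine ⟨4, fun _ => 1 / 2, fun i => z i • ![1, pauliX, pauliY, pauliZ] i, _,
    ⟨fun i => smul_mem_unitaryGroup (hz i) (h.unitary i), fun i j hij => ?_⟩, h, by norm_num,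
    by norm_num, ?_⟩
  · rw [Matrix.conjTranspose_smul, Matrix.smul_mul, Matrix.mul_smul, Matrix.trace_smul,
      Matrix.trace_smul, h.orthogonal i j hij, smul_zero, smul_zero]
  · rw [hU, Fin.sum_univ_four]
    simp [Matrix.smul_kronecker, smul_add]

theorem hasUnitarySchmidt_gateSWAP : HasUnitarySchmidt gateSWAP 2 := by
  refine hasUnitarySchmidt_of_pauli_sum (fun _ => 1) (by simp) ?_
  ext ⟨i, j⟩ ⟨k, l⟩
  fin_cases i <;> fin_cases j <;> fin_cases k <;> fin_cases l <;>
    simp [gateSWAP, pauliX, pauliY, pauliZ] <;> norm_num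

theorem hasUnitarySchmidt_gateISWAP : HasUnitarySchmidt gateISWAP 2 := by
  refine hasUnitarySchmidt_of_pauli_sum ![1, Complex.I, Complex.I, 1] (fun i => ?_) ?_
  · fin_cases i <;> simp
  · ext ⟨i, j⟩ ⟨k, l⟩
    fin_cases i <;> fin_cases j <;> fin_cases k <;> fin_cases l <;>
      simp [gateISWAP, pauliX, pauliY, pauliZ] <;> ring

theorem hasUnitarySchmidt_one : HasUnitarySchmidt 1 1 :=
  ⟨1, fun _ => 1, fun _ => 1, fun _ => 1,
    ⟨fun _ => one_mem _, fun i j h => absurd (Subsingleton.elim i j) h⟩,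
    ⟨fun _ => one_mem _, fun i j h => absurd (Subsingleton.elim i j) h⟩, by simp, by simp,
    by simp⟩

end Gates

/-! ### Anticommuting pairs and local equivalence -/

section Clifford

/-- Two anticommuting Hermitian involutions. -/
structure IsAnticommutingPair (a b : QubitMat) : Prop where
  left_star : aᴴ = a
  right_star : bᴴ = b
  left_sq : a * a = 1
  right_sq : b * b = 1
  anticomm : a * b = -(b * a)

theorem IsAnticommutingPair.symm {a b : QubitMat} (h : IsAnticommutingPair a b) :
    IsAnticommutingPair b a :=
  ⟨h.right_star, h.left_star, h.right_sq, h.left_sq, by rw [h.anticomm, neg_neg]⟩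

/-- The factor `i` makes the product of anticommuting Hermitian operators Hermitian, as in `Y =
iXZ`. -/
theorem IsAnticommutingPair.left_mul {a b : QubitMat} (h : IsAnticommutingPair a b) :
    IsAnticommutingPair a (Complex.I • (a * b)) := by
  have hba : b * a = -(a * b) := h.symm.anticomm
  refine ⟨h.left_star, ?_, h.left_sq, ?_, ?_⟩
  · rw [Matrix.conjTranspose_smul, Matrix.conjTranspose_mul, h.left_star, h.right_star, hba]
    simp
  · rw [Matrix.smul_mul, Matrix.mul_smul, smul_smul, Complex.I_mul_I, Matrix.mul_assoc,
      ← Matrix.mul_assoc b, hba, Matrix.neg_mul, Matrix.mul_neg, ← Matrix.mul_assoc,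
      ← Matrix.mul_assoc, h.left_sq, Matrix.one_mul, h.right_sq]
    simp
  · rw [Matrix.mul_smul, Matrix.smul_mul, Matrix.mul_assoc, hba]
    simp

theorem isAnticommutingPair_XZ : IsAnticommutingPair pauliX pauliZ :=
  ⟨conjTranspose_pauliX, conjTranspose_pauliZ, pauliX_mul_self, pauliZ_mul_self, by
    ext i j; fin_cases i <;> fin_cases j <;> simp [pauliX, pauliZ]⟩

/-- Any pair of anticommuting Hermitian involutions is unitarily equivalent to `X`, `Z`. -/
theorem IsAnticommutingPair.exists_unitary {a b : QubitMat} (h : IsAnticommutingPair a b) :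
    ∃ L ∈ Matrix.unitaryGroup (Fin 2) ℂ, L * pauliX = a * L ∧ L * pauliZ = b * L := by
  obtain ⟨v, hbv, hv⟩ : ∃ v : Fin 2 → ℂ, b *ᵥ v = v ∧ star v ⬝ᵥ v = 1 := by
    -- `w + b w` is fixed by `b`. Were it zero for all `w`, then `b = -1` would commute with `a`,
    -- forcing `a = 0`.
    obtain ⟨w, hw⟩ : ∃ w : Fin 2 → ℂ, w + b *ᵥ w ≠ 0 := by
      by_contra! hw
      have hb : b = -1 := by
        refine Matrix.toLin'.injective (LinearMap.ext fun w => ?_)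
        simpa using eq_neg_of_add_eq_zero_right (hw w)
      have h1 := h.anticomm
      rw [hb, Matrix.mul_neg, Matrix.neg_mul, Matrix.mul_one, Matrix.one_mul, neg_neg] at h1
      have ha : a = 0 := by
        ext i j
        have h2 : -(a i j) = a i j := congrFun (congrFun h1 i) j
        exact neg_eq_self.mp h2
      have := h.left_sq
      rw [ha] at this
      simp at this
    set w' := w + b *ᵥ w
    have hbw : b *ᵥ w' = w' := by
      simp only [w', Matrix.mulVec_add, Matrix.mulVec_mulVec, h.right_sq, Matrix.one_mulVec]
      rw [add_comm]
    have hpos : 0 < (star w' ⬝ᵥ w').re :=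
      (Complex.pos_iff.mp (Matrix.dotProduct_star_self_pos_iff.mpr hw)).1
    have him : star w' ⬝ᵥ w' = ((star w' ⬝ᵥ w').re : ℂ) := by
      refine Complex.ext rfl ?_
      exact (Complex.pos_iff.mp (Matrix.dotProduct_star_self_pos_iff.mpr hw)).2.symm
    set n := (star w' ⬝ᵥ w').re
    refine ⟨((√n)⁻¹ : ℂ) • w', by rw [Matrix.mulVec_smul, hbw], ?_⟩
    rw [star_smul, smul_dotProduct, dotProduct_smul, him, smul_eq_mul, smul_eq_mul]
    have hs : (√n : ℂ) * √n = n := by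
      rw [← Complex.ofReal_mul, Real.mul_self_sqrt hpos.le]
    have hn : (√n : ℂ) ≠ 0 := by
      simpa using (Real.sqrt_pos.mpr hpos).ne'
    rw [← hs, star_inv₀, Complex.star_def, Complex.conj_ofReal]
    field_simp
  have hstar (M : QubitMat) (x y : Fin 2 → ℂ) : star (M *ᵥ x) ⬝ᵥ y = star x ⬝ᵥ (Mᴴ *ᵥ y) := by
    rw [Matrix.star_mulVec, Matrix.dotProduct_mulVec]
  have hvw : star v ⬝ᵥ (a *ᵥ v) = 0 := by
    have h1 : star v ⬝ᵥ (a *ᵥ v) = -(star v ⬝ᵥ (a *ᵥ v)) := by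
      conv_lhs => rw [← hbv, hstar, h.right_star, Matrix.mulVec_mulVec, hbv, h.symm.anticomm,
        Matrix.neg_mulVec, ← Matrix.mulVec_mulVec, hbv, dotProduct_neg]
    exact self_eq_neg.mp h1
  have hwv : star (a *ᵥ v) ⬝ᵥ v = 0 := by rw [hstar, h.left_star, hvw]
  have hww : star (a *ᵥ v) ⬝ᵥ (a *ᵥ v) = 1 := by
    rw [hstar, h.left_star, Matrix.mulVec_mulVec, h.left_sq, Matrix.one_mulVec, hv]
  have haw : a *ᵥ (a *ᵥ v) = v := by rw [Matrix.mulVec_mulVec, h.left_sq, Matrix.one_mulVec]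
  have hbw : b *ᵥ (a *ᵥ v) = -(a *ᵥ v) := by
    rw [Matrix.mulVec_mulVec, h.symm.anticomm, Matrix.neg_mulVec, ← Matrix.mulVec_mulVec, hbv]
  set w := a *ᵥ v with hw
  -- The columns are `v` and `a v`: `a` exchanges them, and `b` fixes the first and negates the
  -- second.
  let L : QubitMat := Matrix.of fun i j => ![v, w] j i
  refine ⟨L, ?_, ?_, ?_⟩
  · rw [Matrix.mem_unitaryGroup_iff']
    simp only [dotProduct, Fin.sum_univ_two, Pi.star_apply] at hv hvw hwv hww
    ext i j
    fin_cases i <;> fin_cases j <;>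
      simpa [L, Matrix.mul_apply, Matrix.star_apply]
  · ext i j
    have h1 := congrFun haw i
    have h2 := congrFun hw i
    simp only [Matrix.mulVec, dotProduct, Fin.sum_univ_two] at h1 h2
    fin_cases j <;> simp [L, Matrix.mul_apply, pauliX, h1, h2]
  · ext i j
    have h1 := congrFun hbv i
    have h2 := congrFun hbw i
    simp only [Matrix.mulVec, dotProduct, Fin.sum_univ_two, Pi.neg_apply] at h1 h2
    fin_cases j <;> simp [L, Matrix.mul_apply, pauliZ, h1, h2]

theorem kronecker_mem_unitaryGroup {L M : QubitMat} (hL : L ∈ Matrix.unitaryGroup (Fin 2) ℂ)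
    (hM : M ∈ Matrix.unitaryGroup (Fin 2) ℂ) :
    L ⊗ₖ M ∈ Matrix.unitaryGroup (Fin 2 × Fin 2) ℂ := by
  rw [Matrix.mem_unitaryGroup_iff, Matrix.star_eq_conjTranspose, Matrix.conjTranspose_kronecker,
    ← Matrix.mul_kronecker_mul, unitary_mul_conjTranspose hL, unitary_mul_conjTranspose hM,
    Matrix.one_kronecker_one]

/-- A two-qubit unitary that commutes with all operators on `A` is a local unitary on `B`. -/
theorem exists_eq_one_kronecker {T : TwoQubitMat}
    (hT : T ∈ Matrix.unitaryGroup (Fin 2 × Fin 2) ℂ)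
    (hX : T * (pauliX ⊗ₖ 1) = (pauliX ⊗ₖ 1) * T) (hZ : T * (pauliZ ⊗ₖ 1) = (pauliZ ⊗ₖ 1) * T) :
    ∃ W ∈ Matrix.unitaryGroup (Fin 2) ℂ, T = 1 ⊗ₖ W := by
  let W : QubitMat := Matrix.of fun j l => T (0, j) (0, l)
  have hTW : T = 1 ⊗ₖ W := by
    have key {σ : QubitMat} (hσ : T * (σ ⊗ₖ 1) = (σ ⊗ₖ 1) * T) (i j k l : Fin 2) :
        ∑ k', T (i, j) (k', l) * σ k' k = ∑ i', σ i i' * T (i', j) (k, l) := by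
      simpa [Matrix.mul_apply, Fintype.sum_prod_type, Matrix.one_apply] using
        congrFun (congrFun hσ (i, j)) (k, l)
    ext ⟨i, j⟩ ⟨k, l⟩
    -- Commuting with `X` makes the two diagonal blocks equal; commuting with `Z` kills the
    -- off-diagonal blocks.
    have h1 := key hX 1 j 0 l
    have h2 := key hZ i j k l
    simp only [Fin.sum_univ_two] at h1 h2
    fin_cases i <;> fin_cases k <;> simp [pauliX, pauliZ, W] at h1 h2 ⊢
    · exact self_eq_neg.mp h2.symm
    · exact self_eq_neg.mp h2
    · exact h1
  refine ⟨W, Matrix.mem_unitaryGroup_iff.mpr ?_, hTW⟩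
  have := unitary_mul_conjTranspose hT
  rw [hTW, Matrix.conjTranspose_kronecker, ← Matrix.mul_kronecker_mul, Matrix.conjTranspose_one,
    Matrix.one_mul] at this
  rw [Matrix.star_eq_conjTranspose]
  ext i j
  simpa [Matrix.one_apply] using congrFun (congrFun this (0, i)) (0, j)

theorem conjTranspose_mul_of_mul_eq {n : Type} [Fintype n] [DecidableEq n] {L x y : Matrix n n ℂ}
    (hL : L ∈ Matrix.unitaryGroup n ℂ) (h : L * x = y * L) : Lᴴ * y = x * Lᴴ := by
  calc Lᴴ * y = Lᴴ * (y * L) * Lᴴ := by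
        rw [Matrix.mul_assoc, Matrix.mul_assoc, unitary_mul_conjTranspose hL, Matrix.mul_one]
    _ = x * Lᴴ := by
        rw [← h, ← Matrix.mul_assoc, unitary_conjTranspose_mul hL, Matrix.one_mul]

/-- `U` is equal to `C` up to local unitaries. -/
def LocallyEquivalent (U C : TwoQubitMat) : Prop :=
  ∃ L ∈ Matrix.unitaryGroup (Fin 2) ℂ, ∃ M ∈ Matrix.unitaryGroup (Fin 2) ℂ,
    ∃ R ∈ Matrix.unitaryGroup (Fin 2) ℂ, ∃ W ∈ Matrix.unitaryGroup (Fin 2) ℂ,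
      U = (L ⊗ₖ M) * C * (R ⊗ₖ W)

/-- With `R` and `L` carrying `X, Z` to `g, h` and to `a, a'`, the unitaries `U (R ⊗ 1)` and `V = (L
⊗ M) C` conjugate `X ⊗ 1` and `Z ⊗ 1` in the same way. Hence `V† U (R ⊗ 1)` commutes with all
operators on `A` and has the form `1 ⊗ W`. -/
theorem locallyEquivalent_of_intertwines {U C : TwoQubitMat} {g h a a' b b₀ M : QubitMat}
    (hU : U ∈ Matrix.unitaryGroup (Fin 2 × Fin 2) ℂ)
    (hC : C ∈ Matrix.unitaryGroup (Fin 2 × Fin 2) ℂ)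
    (hgh : IsAnticommutingPair g h) (haa' : IsAnticommutingPair a a')
    (hM : M ∈ Matrix.unitaryGroup (Fin 2) ℂ) (hMb : M * b₀ = b * M)
    (hCX : C * (pauliX ⊗ₖ 1) = (pauliX ⊗ₖ b₀) * C) (hCZ : C * (pauliZ ⊗ₖ 1) = (pauliZ ⊗ₖ 1) * C)
    (hg : U * (g ⊗ₖ 1) = (a ⊗ₖ b) * U) (hh : U * (h ⊗ₖ 1) = (a' ⊗ₖ 1) * U) :
    LocallyEquivalent U C := by
  obtain ⟨R, hR, hRX, hRZ⟩ := hgh.exists_unitary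
  obtain ⟨L, hL, hLX, hLZ⟩ := haa'.exists_unitary
  have hV : (L ⊗ₖ M) * C ∈ Matrix.unitaryGroup (Fin 2 × Fin 2) ℂ :=
    mul_mem (kronecker_mem_unitaryGroup hL hM) hC
  set V := (L ⊗ₖ M) * C with hVdef
  have hVX : V * (pauliX ⊗ₖ 1) = (a ⊗ₖ b) * V := by
    rw [hVdef, Matrix.mul_assoc, hCX, ← Matrix.mul_assoc, ← Matrix.mul_assoc,
      ← Matrix.mul_kronecker_mul, ← Matrix.mul_kronecker_mul, hLX, hMb]
  have hVZ : V * (pauliZ ⊗ₖ 1) = (a' ⊗ₖ 1) * V := by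
    rw [hVdef, Matrix.mul_assoc, hCZ, ← Matrix.mul_assoc, ← Matrix.mul_assoc,
      ← Matrix.mul_kronecker_mul, ← Matrix.mul_kronecker_mul, hLZ, Matrix.mul_one,
      Matrix.one_mul]
  have hR1 := kronecker_mem_unitaryGroup hR (one_mem (Matrix.unitaryGroup (Fin 2) ℂ))
  have comm {p q r s : QubitMat} (h1 : R * p = q * R) (h2 : U * (q ⊗ₖ 1) = (r ⊗ₖ s) * U)
      (h3 : V * (p ⊗ₖ 1) = (r ⊗ₖ s) * V) :
      (Vᴴ * U * (R ⊗ₖ 1)) * (p ⊗ₖ 1) = (p ⊗ₖ 1) * (Vᴴ * U * (R ⊗ₖ 1)) := by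
    have h4 : (R ⊗ₖ (1 : QubitMat)) * (p ⊗ₖ 1) = (q ⊗ₖ 1) * (R ⊗ₖ 1) := by
      rw [← Matrix.mul_kronecker_mul, h1, Matrix.mul_kronecker_mul]
    rw [Matrix.mul_assoc, h4, ← Matrix.mul_assoc, Matrix.mul_assoc Vᴴ, h2, ← Matrix.mul_assoc,
      conjTranspose_mul_of_mul_eq hV h3]
    simp only [Matrix.mul_assoc]
  obtain ⟨W, hW, hT⟩ := exists_eq_one_kronecker
    (mul_mem (mul_mem (Unitary.star_mem hV) hU) hR1) (comm hRX hg hVX) (comm hRZ hh hVZ)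
  refine ⟨L, hL, M, hM, Rᴴ, Unitary.star_mem hR, W, hW, ?_⟩
  have hRW : (1 ⊗ₖ W) * (R ⊗ₖ (1 : QubitMat))ᴴ = Rᴴ ⊗ₖ W := by
    rw [Matrix.conjTranspose_kronecker, ← Matrix.mul_kronecker_mul]
    simp
  rw [← hRW, ← hT, ← hVdef, Matrix.star_eq_conjTranspose, Matrix.mul_assoc _ _ (R ⊗ₖ 1)ᴴ,
    unitary_mul_conjTranspose hR1, Matrix.mul_one,
    ← Matrix.mul_assoc, unitary_mul_conjTranspose hV, Matrix.one_mul]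

end Clifford

/-! ### Clifford gates up to local unitaries -/

section CliffordClassification

theorem pauli_comm_or_anticomm {σ τ : QubitMat}
    (hσ : σ ∈ ({1, pauliX, pauliY, pauliZ} : Set QubitMat))
    (hτ : τ ∈ ({1, pauliX, pauliY, pauliZ} : Set QubitMat)) :
    (σ * τ = τ * σ ∧ (σ = 1 ∨ τ = 1 ∨ σ = τ)) ∨ σ * τ = -(τ * σ) := by
  have hXY : pauliX * pauliY = -(pauliY * pauliX) := by
    ext i j; fin_cases i <;> fin_cases j <;> simp [pauliX, pauliY]
  have hXZ : pauliX * pauliZ = -(pauliZ * pauliX) := by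
    ext i j; fin_cases i <;> fin_cases j <;> simp [pauliX, pauliZ]
  have hYZ : pauliY * pauliZ = -(pauliZ * pauliY) := by
    ext i j; fin_cases i <;> fin_cases j <;> simp [pauliY, pauliZ]
  rcases hσ with rfl | rfl | rfl | rfl <;> rcases hτ with rfl | rfl | rfl | rfl <;>
    simp [hXY, hXZ, hYZ]

theorem pauli_star_and_sq {σ : QubitMat}
    (hσ : σ ∈ ({1, pauliX, pauliY, pauliZ} : Set QubitMat)) : σᴴ = σ ∧ σ * σ = 1 := by
  rcases hσ with rfl | hσ
  · simp
  · exact ⟨(pauli_properties hσ).1, (pauli_properties hσ).2.1⟩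

theorem eq_one_or_exists_isAnticommutingPair {b : QubitMat}
    (hb : b ∈ ({1, pauliX, pauliY, pauliZ} : Set QubitMat)) :
    b = 1 ∨ ∃ a, IsAnticommutingPair a b := by
  rcases hb with rfl | rfl | rfl | rfl
  · exact Or.inl rfl
  · exact Or.inr ⟨pauliZ, isAnticommutingPair_XZ.symm⟩
  · refine Or.inr ⟨pauliZ, conjTranspose_pauliZ, conjTranspose_pauliY, pauliZ_mul_self,
      pauliY_mul_self, ?_⟩
    ext i j; fin_cases i <;> fin_cases j <;> simp [pauliY, pauliZ]
  · exact Or.inr ⟨pauliX, isAnticommutingPair_XZ⟩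

theorem controlledZ_eq :
    controlled pauliZ = Matrix.diagonal fun p => if p = (1, 1) then -1 else 1 := by
  ext ⟨i, j⟩ ⟨k, l⟩
  fin_cases i <;> fin_cases j <;> fin_cases k <;> fin_cases l <;>
    simp [controlled, pauliZ]

theorem controlledZ_mem_unitaryGroup :
    controlled pauliZ ∈ Matrix.unitaryGroup (Fin 2 × Fin 2) ℂ := by
  refine mem_unitaryGroup_of_involution ?_ ?_
  · rw [controlledZ_eq, Matrix.diagonal_conjTranspose]
    congr 1
    ext p
    by_cases hp : p = (1, 1) <;> simp [hp]
  · rw [controlledZ_eq, Matrix.diagonal_mul_diagonal, ← Matrix.diagonal_one]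
    congr 1
    ext p
    by_cases hp : p = (1, 1) <;> simp [hp]

theorem controlledZ_mul_X : controlled pauliZ * (pauliX ⊗ₖ 1) =
    (pauliX ⊗ₖ pauliZ) * controlled pauliZ := by
  rw [controlledZ_eq]
  ext ⟨i, j⟩ ⟨k, l⟩
  rw [Matrix.diagonal_mul, Matrix.mul_diagonal]
  fin_cases i <;> fin_cases j <;> fin_cases k <;> fin_cases l <;> simp [pauliX, pauliZ]

theorem controlledZ_mul_Z : controlled pauliZ * (pauliZ ⊗ₖ 1) =
    (pauliZ ⊗ₖ 1) * controlled pauliZ := by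
  rw [controlledZ_eq]
  ext ⟨i, j⟩ ⟨k, l⟩
  rw [Matrix.diagonal_mul, Matrix.mul_diagonal]
  fin_cases i <;> fin_cases j <;> fin_cases k <;> fin_cases l <;> simp [pauliZ]

/-- If `b = 1`, the identity is a model for `U`. Otherwise `b` is unitarily equivalent to `Z`, and
CZ is a model: it sends `X ⊗ 1` to `X ⊗ Z` and fixes `Z ⊗ 1`. -/
theorem locallyEquivalent_one_or_controlledZ_of_intertwines {U : TwoQubitMat}
    {g h a a' b : QubitMat} (hU : U ∈ Matrix.unitaryGroup (Fin 2 × Fin 2) ℂ)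
    (hgh : IsAnticommutingPair g h) (haa' : IsAnticommutingPair a a')
    (hb : b ∈ ({1, pauliX, pauliY, pauliZ} : Set QubitMat))
    (hg : U * (g ⊗ₖ 1) = (a ⊗ₖ b) * U) (hh : U * (h ⊗ₖ 1) = (a' ⊗ₖ 1) * U) :
    LocallyEquivalent U 1 ∨ LocallyEquivalent U (controlled pauliZ) := by
  rcases eq_one_or_exists_isAnticommutingPair hb with rfl | ⟨b', hb'⟩
  · refine Or.inl (locallyEquivalent_of_intertwines hU (one_mem _) hgh haa' (one_mem _)
      (b₀ := 1) rfl ?_ ?_ hg hh) <;> rw [Matrix.one_mul, Matrix.mul_one]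
  · obtain ⟨M, hM, -, hMZ⟩ := hb'.exists_unitary
    exact Or.inr (locallyEquivalent_of_intertwines hU controlledZ_mem_unitaryGroup hgh haa' hM
      hMZ controlledZ_mul_X controlledZ_mul_Z hg hh)

/-- In each case one of `X`, `Z`, `iXZ` has an image acting trivially on `B`: for `τ = τ'` it is
`iXZ`, because `τ² = 1`. This operator plays the role of `h`. -/
theorem locallyEquivalent_one_or_controlledZ {U : TwoQubitMat} {a a' τ τ' : QubitMat}
    (hU : U ∈ Matrix.unitaryGroup (Fin 2 × Fin 2) ℂ) (haa' : IsAnticommutingPair a a')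
    (hτ : τ ∈ ({1, pauliX, pauliY, pauliZ} : Set QubitMat))
    (hτ' : τ' ∈ ({1, pauliX, pauliY, pauliZ} : Set QubitMat)) (hττ' : τ = 1 ∨ τ' = 1 ∨ τ = τ')
    (hX : U * (pauliX ⊗ₖ 1) = (a ⊗ₖ τ) * U) (hZ : U * (pauliZ ⊗ₖ 1) = (a' ⊗ₖ τ') * U) :
    LocallyEquivalent U 1 ∨ LocallyEquivalent U (controlled pauliZ) := by
  rcases hττ' with rfl | rfl | rfl
  · exact locallyEquivalent_one_or_controlledZ_of_intertwines hU isAnticommutingPair_XZ.symm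
      haa'.symm hτ' hZ hX
  · exact locallyEquivalent_one_or_controlledZ_of_intertwines hU isAnticommutingPair_XZ haa' hτ
      hX hZ
  · refine locallyEquivalent_one_or_controlledZ_of_intertwines hU
      isAnticommutingPair_XZ.left_mul haa'.left_mul hτ hX ?_
    have h : U * ((pauliX * pauliZ) ⊗ₖ 1) = ((a * a') ⊗ₖ 1) * U := by
      rw [← Matrix.one_mul (1 : QubitMat), Matrix.mul_kronecker_mul, ← Matrix.mul_assoc, hX,
        Matrix.mul_assoc, hZ, ← Matrix.mul_assoc, ← Matrix.mul_kronecker_mul,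
        (pauli_star_and_sq hτ).2, Matrix.one_mul]
    rw [Matrix.smul_kronecker, Matrix.smul_kronecker, Matrix.mul_smul, Matrix.smul_mul, h]

theorem gateSWAP_mul_kronecker (a b : QubitMat) : gateSWAP * (a ⊗ₖ b) = (b ⊗ₖ a) * gateSWAP := by
  ext ⟨i, j⟩ ⟨k, l⟩
  simp only [gateSWAP, Matrix.mul_apply, Matrix.of_apply, Matrix.kroneckerMap_apply,
    Fintype.sum_prod_type, Prod.swap, Prod.mk.injEq, ite_and, ite_mul, mul_ite, one_mul, mul_one,
    zero_mul, mul_zero, Finset.sum_ite_eq, Finset.sum_ite_eq', Finset.mem_univ, if_true]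
  simp [mul_comm]

theorem gateSWAP_mul_self : gateSWAP * gateSWAP = 1 := by
  ext ⟨i, j⟩ ⟨k, l⟩
  fin_cases i <;> fin_cases j <;> fin_cases k <;> fin_cases l <;>
    simp [gateSWAP, Matrix.mul_apply]

theorem gateSWAP_mem_unitaryGroup : gateSWAP ∈ Matrix.unitaryGroup (Fin 2 × Fin 2) ℂ := by
  refine mem_unitaryGroup_of_involution ?_ gateSWAP_mul_self
  ext ⟨i, j⟩ ⟨k, l⟩
  fin_cases i <;> fin_cases j <;> fin_cases k <;> fin_cases l <;> simp [gateSWAP]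

theorem LocallyEquivalent.of_gateSWAP_mul {U C : TwoQubitMat}
    (h : LocallyEquivalent (gateSWAP * U) C) : LocallyEquivalent U (gateSWAP * C) := by
  obtain ⟨L, hL, M, hM, R, hR, W, hW, h⟩ := h
  refine ⟨M, hM, L, hL, R, hR, W, hW, ?_⟩
  rw [← Matrix.mul_assoc, ← gateSWAP_mul_kronecker, Matrix.mul_assoc, Matrix.mul_assoc,
    ← Matrix.mul_assoc (L ⊗ₖ M), ← h, ← Matrix.mul_assoc, gateSWAP_mul_self, Matrix.one_mul]

theorem LocallyEquivalent.hasUnitarySchmidt {U C : TwoQubitMat} {s : ℝ}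
    (h : LocallyEquivalent U C) (hC : HasUnitarySchmidt C s) : HasUnitarySchmidt U s := by
  obtain ⟨L, hL, M, hM, R, hR, W, hW, rfl⟩ := h
  exact hC.local_mul_mul hL hM hR hW

/-- Phase gates `diag(1, -i)` on both qubits cancel the `i` of iSWAP and produce `-1` on `|11⟩`. -/
theorem hasUnitarySchmidt_gateSWAP_mul_controlledZ :
    HasUnitarySchmidt (gateSWAP * controlled pauliZ) 2 := by
  have hp := phaseGate_mem_unitaryGroup (z := -Complex.I) (by simp)
  have h := hasUnitarySchmidt_gateISWAP.local_mul_mul (one_mem _) (one_mem _) hp hp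
  have hU : gateSWAP * controlled pauliZ =
      (1 ⊗ₖ 1) * gateISWAP * (phaseGate (-Complex.I) ⊗ₖ phaseGate (-Complex.I)) := by
    have hd : phaseGate (-Complex.I) ⊗ₖ phaseGate (-Complex.I) =
        Matrix.diagonal fun p =>
          phaseGate (-Complex.I) p.1 p.1 * phaseGate (-Complex.I) p.2 p.2 := by
      ext ⟨i, j⟩ ⟨k, l⟩
      fin_cases i <;> fin_cases j <;> fin_cases k <;> fin_cases l <;>
        simp [phaseGate]
    rw [Matrix.one_kronecker_one, Matrix.one_mul, hd, controlledZ_eq]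
    ext ⟨i, j⟩ ⟨k, l⟩
    rw [Matrix.mul_diagonal, Matrix.mul_diagonal]
    fin_cases i <;> fin_cases j <;> fin_cases k <;> fin_cases l <;>
      simp [phaseGate, gateSWAP, gateISWAP]
  rwa [hU]

/-- A Clifford gate maps a Hermitian Pauli operator to a Pauli operator with a sign. -/
theorem IsClifford₂.exists_intertwines {U : TwoQubitMat} (hU : IsClifford₂ U) {g : QubitMat}
    (hg : g ∈ ({1, pauliX, pauliY, pauliZ} : Set QubitMat)) :
    ∃ ε : ℂ, star ε = ε ∧ ε * ε = 1 ∧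
      ∃ σ ∈ ({1, pauliX, pauliY, pauliZ} : Set QubitMat),
        ∃ τ ∈ ({1, pauliX, pauliY, pauliZ} : Set QubitMat),
          U * (g ⊗ₖ 1) = (ε • (σ ⊗ₖ τ)) * U := by
  have hmem : U * (g ⊗ₖ 1) * Uᴴ ∈ pauliGroup₂ := by
    rw [← hU.2]
    exact ⟨_, ⟨0, g, 1, hg, Or.inl rfl, by rw [pow_zero, one_smul]⟩, rfl⟩
  obtain ⟨k, σ, τ, hσ, hτ, h⟩ := hmem
  have hUU := unitary_conjTranspose_mul hU.1
  -- The image of the involution `g ⊗ 1` is an involution, so the phase `i^k` is `±1`.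
  have hsq : (Complex.I ^ k * Complex.I ^ k) • (1 : TwoQubitMat) = 1 := by
    have h1 : (Complex.I ^ k • (σ ⊗ₖ τ)) * (Complex.I ^ k • (σ ⊗ₖ τ)) = 1 := by
      calc _ = U * (g ⊗ₖ 1) * (Uᴴ * U) * (g ⊗ₖ 1) * Uᴴ := by
            rw [← h]; simp only [Matrix.mul_assoc]
        _ = 1 := by
            rw [hUU, Matrix.mul_one, Matrix.mul_assoc U, ← Matrix.mul_kronecker_mul,
              (pauli_star_and_sq hg).2, Matrix.one_mul, Matrix.one_kronecker_one, Matrix.mul_one,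
              unitary_mul_conjTranspose hU.1]
    rwa [Matrix.smul_mul, Matrix.mul_smul, smul_smul, ← Matrix.mul_kronecker_mul,
      (pauli_star_and_sq hσ).2, (pauli_star_and_sq hτ).2, Matrix.one_kronecker_one] at h1
  have hε : Complex.I ^ k * Complex.I ^ k = 1 := by
    simpa using congrFun (congrFun hsq (0, 0)) (0, 0)
  refine ⟨Complex.I ^ k, ?_, hε, σ, hσ, τ, hτ, ?_⟩
  · rcases mul_self_eq_one_iff.mp hε with h | h <;> simp [h]
  · rw [← h, Matrix.mul_assoc, hUU, Matrix.mul_one]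

theorem isAnticommutingPair_smul {ε δ : ℂ} {σ τ : QubitMat} (hε : star ε = ε) (hδ : star δ = δ)
    (hε' : ε * ε = 1) (hδ' : δ * δ = 1)
    (hσ : σ ∈ ({1, pauliX, pauliY, pauliZ} : Set QubitMat))
    (hτ : τ ∈ ({1, pauliX, pauliY, pauliZ} : Set QubitMat)) (h : σ * τ = -(τ * σ)) :
    IsAnticommutingPair (ε • σ) (δ • τ) := by
  obtain ⟨h₁, h₂⟩ := pauli_star_and_sq hσ
  obtain ⟨h₃, h₄⟩ := pauli_star_and_sq hτ
  refine ⟨by rw [Matrix.conjTranspose_smul, hε, h₁], by rw [Matrix.conjTranspose_smul, hδ, h₃],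
    ?_, ?_, ?_⟩
  · rw [Matrix.smul_mul, Matrix.mul_smul, smul_smul, hε', h₂, one_smul]
  · rw [Matrix.smul_mul, Matrix.mul_smul, smul_smul, hδ', h₄, one_smul]
  · rw [Matrix.smul_mul, Matrix.mul_smul, Matrix.smul_mul, Matrix.mul_smul, h, smul_comm,
      smul_neg, smul_neg]

/-- Up to local unitaries, a two-qubit Clifford gate is trivial, a controlled-`Z` gate, a swap, or
a swap after a controlled-`Z` gate. -/
theorem IsClifford₂.locallyEquivalent {U : TwoQubitMat} (hU : IsClifford₂ U) :
    LocallyEquivalent U 1 ∨ LocallyEquivalent U (controlled pauliZ) ∨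
      LocallyEquivalent U gateSWAP ∨ LocallyEquivalent U (gateSWAP * controlled pauliZ) := by
  obtain ⟨ε, hε, hε', σ, hσ, τ, hτ, hX⟩ := hU.exists_intertwines (g := pauliX) (by simp)
  obtain ⟨δ, hδ, hδ', σ', hσ', τ', hτ', hZ⟩ := hU.exists_intertwines (g := pauliZ) (by simp)
  -- The images of `X ⊗ 1` and `Z ⊗ 1` anticommute; the signs `ε`, `δ` cancel.
  have hanti : (σ * σ') ⊗ₖ (τ * τ') = -((σ' * σ) ⊗ₖ (τ' * τ)) := by
    have h1 : U * ((pauliX * pauliZ) ⊗ₖ 1) = ((ε * δ) • ((σ * σ') ⊗ₖ (τ * τ'))) * U := by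
      rw [← Matrix.one_mul (1 : QubitMat), Matrix.mul_kronecker_mul, ← Matrix.mul_assoc, hX,
        Matrix.mul_assoc, hZ, ← Matrix.mul_assoc, Matrix.smul_mul, Matrix.mul_smul, smul_smul,
        ← Matrix.mul_kronecker_mul]
    have h2 : U * ((pauliZ * pauliX) ⊗ₖ 1) = ((ε * δ) • ((σ' * σ) ⊗ₖ (τ' * τ))) * U := by
      rw [← Matrix.one_mul (1 : QubitMat), Matrix.mul_kronecker_mul, ← Matrix.mul_assoc, hZ,
        Matrix.mul_assoc, hX, ← Matrix.mul_assoc, Matrix.smul_mul, Matrix.mul_smul, smul_smul,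
        ← Matrix.mul_kronecker_mul, mul_comm δ]
    have h3 : (pauliX * pauliZ) ⊗ₖ (1 : QubitMat) = (-1 : ℂ) • ((pauliZ * pauliX) ⊗ₖ 1) := by
      rw [isAnticommutingPair_XZ.anticomm, ← neg_one_smul ℂ, Matrix.smul_kronecker]
    rw [h3, Matrix.mul_smul, h2] at h1
    have h4 := congrArg (fun M => (ε * δ) • (M * Uᴴ)) h1
    have h5 : ε * δ * (ε * δ) = 1 := by rw [mul_mul_mul_comm, hε', hδ', one_mul]
    simp only [Matrix.smul_mul, Matrix.mul_assoc, unitary_mul_conjTranspose hU.1, Matrix.mul_one,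
      smul_smul, h5, one_smul] at h4
    rw [← h4, neg_one_mul, mul_neg, h5, neg_one_smul]
  have hne : (σ' * σ) ⊗ₖ (τ' * τ) ≠ -((σ' * σ) ⊗ₖ (τ' * τ)) := by
    intro h
    have h0 : (σ' * σ) ⊗ₖ (τ' * τ) = 0 := by
      ext i j
      exact self_eq_neg.mp (congrFun (congrFun h i) j)
    have h1 : ((σ * σ') ⊗ₖ (τ * τ')) * ((σ' * σ) ⊗ₖ (τ' * τ)) = 1 := by
      rw [← Matrix.mul_kronecker_mul, Matrix.mul_assoc, ← Matrix.mul_assoc σ',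
        (pauli_star_and_sq hσ').2, Matrix.one_mul, (pauli_star_and_sq hσ).2, Matrix.mul_assoc,
        ← Matrix.mul_assoc τ', (pauli_star_and_sq hτ').2, Matrix.one_mul,
        (pauli_star_and_sq hτ).2, Matrix.one_kronecker_one]
    rw [h0, Matrix.mul_zero] at h1
    simpa using congrFun (congrFun h1 (0, 0)) (0, 0)
  -- Exactly one of the two tensor factors must anticommute. If it is the one on `B`, a swap moves
  -- it to `A`.
  rcases pauli_comm_or_anticomm hσ hσ' with ⟨hσσ', hσσ''⟩ | hσσ' <;>
    rcases pauli_comm_or_anticomm hτ hτ' with ⟨hττ', hττ''⟩ | hττ'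
  · rw [hσσ', hττ'] at hanti
    exact absurd hanti hne
  · have hs := mul_mem gateSWAP_mem_unitaryGroup hU.1
    have key {g σ τ : QubitMat} {ε : ℂ} (h : U * (g ⊗ₖ 1) = (ε • (σ ⊗ₖ τ)) * U) :
        gateSWAP * U * (g ⊗ₖ 1) = ((ε • τ) ⊗ₖ σ) * (gateSWAP * U) := by
      rw [Matrix.mul_assoc, h, ← Matrix.mul_assoc, ← Matrix.kronecker_smul,
        gateSWAP_mul_kronecker, Matrix.mul_assoc]
    have h := locallyEquivalent_one_or_controlledZ hs
      (isAnticommutingPair_smul hε hδ hε' hδ' hτ hτ' hττ') hσ hσ' hσσ'' (key hX) (key hZ)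
    rcases h with h | h
    · exact Or.inr (Or.inr (Or.inl (by simpa using h.of_gateSWAP_mul)))
    · exact Or.inr (Or.inr (Or.inr h.of_gateSWAP_mul))
  · rw [← Matrix.smul_kronecker] at hX hZ
    rcases locallyEquivalent_one_or_controlledZ hU.1
      (isAnticommutingPair_smul hε hδ hε' hδ' hσ hσ' hσσ') hτ hτ' hττ'' hX hZ with h | h
    · exact Or.inl h
    · exact Or.inr (Or.inl h)
  · rw [hσσ', hττ', ← neg_one_smul ℂ (σ' * σ), ← neg_one_smul ℂ (τ' * τ),
      Matrix.smul_kronecker, Matrix.kronecker_smul, smul_smul, neg_one_mul, neg_neg,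
      one_smul] at hanti
    exact absurd hanti hne

end CliffordClassification

end

/-! ### The γ-factors of the gates -/

theorem corollary2 :
    (∀ U : TwoQubitMat, IsClifford₂ U →
      ∃ g ∈ ({1, 3, 7} : Set ℝ), ∀ S ∈ qubitSettings, IsGammaFactor S U g) ∧
    (∀ S ∈ qubitSettings, IsGammaFactor S gateCNOT 3) ∧
    (∀ S ∈ qubitSettings, IsGammaFactor S gateISWAP 7) ∧
    (∀ S ∈ qubitSettings, IsGammaFactor S gateSWAP 7) ∧
    (∀ σ ∈ ({pauliX, pauliY, pauliZ} : Set QubitMat), ∀ θ ∈ Set.Icc (0 : ℝ) (2 * Real.pi),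
      ∀ S ∈ qubitSettings, IsGammaFactor S (gateCR σ θ) (1 + 2 * |Real.sin (θ / 2)|)) ∧
    (∀ σ ∈ ({pauliX, pauliY, pauliZ} : Set QubitMat), ∀ θ ∈ Set.Icc (0 : ℝ) (2 * Real.pi),
      ∀ S ∈ qubitSettings, IsGammaFactor S (gateRR σ θ) (1 + 2 * |Real.sin θ|)) := by
  -- Two-term decompositions have coefficients `cos x`, `sin x`, with `x = π/4` for a controlled
  -- Pauli, `θ/4` for `CR` and `θ/2` for `RR`.
  have hangle (x : ℝ) : 2 * (|Real.cos x| + |Real.sin x|) ^ 2 - 1 =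
      1 + 2 * |Real.sin (2 * x)| := by
    rw [two_mul_abs_add_abs_sq (Real.cos_sq_add_sin_sq x), Real.sin_two_mul]
  have h1 {U : TwoQubitMat} (h : HasUnitarySchmidt U 1) :
      ∀ S ∈ qubitSettings, IsGammaFactor S U 1 := by
    convert h.isGammaFactor using 3
    norm_num
  have h7 {U : TwoQubitMat} (h : HasUnitarySchmidt U 2) :
      ∀ S ∈ qubitSettings, IsGammaFactor S U 7 := by
    convert h.isGammaFactor using 3
    norm_num
  have h3 {U : TwoQubitMat}
      (h : HasUnitarySchmidt U (|Real.cos (Real.pi / 4)| + |Real.sin (Real.pi / 4)|)) :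
      ∀ S ∈ qubitSettings, IsGammaFactor S U 3 := by
    convert h.isGammaFactor using 3
    rw [hangle, show 2 * (Real.pi / 4) = Real.pi / 2 by ring, Real.sin_pi_div_two]
    norm_num
  refine ⟨fun U hU => ?_, h3 (hasUnitarySchmidt_controlled (by simp)),
    h7 hasUnitarySchmidt_gateISWAP, h7 hasUnitarySchmidt_gateSWAP, fun σ hσ θ _ => ?_,
    fun σ hσ θ _ => ?_⟩
  · rcases hU.locallyEquivalent with h | h | h | h
    · exact ⟨1, by simp, h1 (h.hasUnitarySchmidt hasUnitarySchmidt_one)⟩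
    · exact ⟨3, by simp, h3 (h.hasUnitarySchmidt (hasUnitarySchmidt_controlled (by simp)))⟩
    · exact ⟨7, by simp, h7 (h.hasUnitarySchmidt hasUnitarySchmidt_gateSWAP)⟩
    · exact ⟨7, by simp,
        h7 (h.hasUnitarySchmidt hasUnitarySchmidt_gateSWAP_mul_controlledZ)⟩
  · convert (hasUnitarySchmidt_gateCR hσ θ).isGammaFactor using 3
    rw [hangle, show 2 * (θ / 4) = θ / 2 by ring]
  · convert (hasUnitarySchmidt_gateRR hσ θ).isGammaFactor using 3
    rw [hangle, show 2 * (θ / 2) = θ by ring]
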